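/- For a finite simple graph $G$ let $\delta(G)$ be its minimum degree, let $h(G)$ be the number of distinct Hamilton cycles of $G$ (counted as subgraphs), and let $\mathrm{reg}(G)$ be the largest integer $r\ge 0$ such that $G$ contains an $r$-factor, that is, an $r$-regular spanning subgraph. There are a function $\varepsilon:\mathbb N\to\mathbb R$ with $\varepsilon(n)\to 0$ as $n\to\infty$ and an integer $N$ such that for every $n\ge N$ and every graph $G$ on $n$ vertices with $\delta(G)\ge n/2$, $$h(G)\ \ge\ \left(\frac{\mathrm{reg}(G)}{e}\right)^n\bigl(1-\varepsilon(n)\bigr)^n .$$ -/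

import Mathlib

open Filter Topology

universe u

namespace DenseHamilton

open Classical in
/-- `G` contains an `r`-factor: an `r`-regular spanning subgraph. -/
def HasFactor {V : Type u} [Fintype V] (G : SimpleGraph V) (r : ℕ) : Prop :=
  ∃ H : SimpleGraph V, H ≤ G ∧ H.IsRegularOfDegree r

/-- `reg(G)`: the largest `r` (of either parity) such that `G` contains an `r`-factor.
The maximum exists as soon as `G` has a vertex, see `isGreatest_reg`. -/
noncomputable def reg {V : Type u} [Fintype V] (G : SimpleGraph V) : ℕ :=
  sSup {r : ℕ | HasFactor G r}

theorem isGreatest_reg {V : Type u} [Fintype V] [Nonempty V] (G : SimpleGraph V) :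
    IsGreatest {r : ℕ | HasFactor G r} (reg G) := by
  classical
  have hne : {r : ℕ | HasFactor G r}.Nonempty :=
    ⟨0, ⊥, bot_le, fun v => by simp⟩
  have hbdd : BddAbove {r : ℕ | HasFactor G r} := by
    refine ⟨Fintype.card V, ?_⟩
    rintro r ⟨H, -, hH⟩
    obtain ⟨v⟩ := ‹Nonempty V›
    rw [← hH v]
    exact (H.degree_lt_card_verts v).le
  exact ⟨Nat.sSup_mem hne hbdd, fun r hr => le_csSup hbdd hr⟩

/-- The Hamilton cycles of `G`, as subgraphs of `G`: closed walks that differ only in their starting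
point or direction trace the same Hamilton cycle. -/
def hamiltonCycles {V : Type u} [DecidableEq V] (G : SimpleGraph V) : Set G.Subgraph :=
  {C | ∃ (a : V) (p : G.Walk a a), p.IsHamiltonianCycle ∧ C = p.toSubgraph}

/-- `h(G)`: the number of distinct Hamilton cycles in `G`. -/
noncomputable def numHamiltonCycles {V : Type u} [DecidableEq V] (G : SimpleGraph V) : ℕ :=
  (hamiltonCycles G).ncard

end DenseHamilton

/-! Let n = |V|. The count goes through permutations. A doubly stochastic matrix has permanent at
least e⁻ⁿ (`exp_neg_card_le_permanent`, by Gurvits's capacity method), so a doubly stochastic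
weighting of the arcs of `G` with all weights at most 1/q yields (q/e)ⁿ permutations that move every
vertex along an edge. Here q = max(reg G, s⁴): the weights are uniform on a largest regular factor
if reg G ≥ s⁴, and otherwise on a union of s⁴ partial matchings obtained greedily from Hall's
theorem (`exists_weighting`). Thus no lower bound on reg G is needed.

Such permutations may have many short cycles. To exclude them, the vertices are distributed at
random over m = s² layers, and only arcs from a layer to the next one survive, with weights scaled
by m. By a second moment argument, for at least half of the layerings the scaled weights can be
trimmed to row and column sums at most 1 at the price of a missing mass of at most t
(`exists_many_layerings`), and t dummy points absorb this mass (`exp_neg_le_card_perm_mul`). Each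
good layering then carries about (q/(em))ⁿ permutations. Their arcs between vertices climb through
the layers, so they form paths, at most t in number. Conversely, the permutation and the layers of
the starting points of its paths determine the layering; summing over the mⁿ layerings therefore
regains the lost factor m⁻ⁿ up to mᵗ. Joining the paths end to end gives, up to a factor n^{O(t)},
at least (q/e)ⁿ enumerations of V with at most t + 1 cyclically consecutive non-edges
(`card_layered_perms_lower`, `card_layered_perms_le`).

Finally, Dirac's rotation argument removes a non-edge at the cost of a factor n²
(`card_nearCycles_le`), and each Hamilton cycle comes from at most n² enumerations
(`card_nearCycles_zero_le`). With s about n^{1/5} one has t = O(n^{4/5}), so all losses together are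
n^{O(t)} = e^{o(n)}. -/

namespace DenseHamilton

/-! ### Permanents of doubly stochastic matrices, by stable polynomials and capacity. -/

section Permanent

-- Each factor satisfies s + b ≤ b e^{s/b}, and the sum of the 1/b is the ratio of the coefficients
-- of degree 1 and degree 0.
open Polynomial in
theorem prod_X_add_C_growth (S : Multiset ℝ) (hS : ∀ b ∈ S, 0 < b) :
    0 < (S.map fun b => (X + C b : ℝ[X])).prod.coeff 0 ∧
    0 ≤ (S.map fun b => (X + C b : ℝ[X])).prod.coeff 1 ∧
    ∀ s : ℝ, 0 ≤ s → 0 ≤ (S.map fun b => (X + C b : ℝ[X])).prod.eval s ∧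
      (S.map fun b => (X + C b : ℝ[X])).prod.eval s ≤
      (S.map fun b => (X + C b : ℝ[X])).prod.coeff 0 *
        Real.exp (s * (S.map fun b => (X + C b : ℝ[X])).prod.coeff 1 /
          (S.map fun b => (X + C b : ℝ[X])).prod.coeff 0) := by
  induction S using Multiset.induction with
  | empty => simp [coeff_one]
  | cons b S ih =>
    obtain ⟨h0, h1, h2⟩ := ih fun c hc => hS c (Multiset.mem_cons_of_mem hc)
    have hb : 0 < b := hS b (Multiset.mem_cons_self b S)
    simp only [Multiset.map_cons, Multiset.prod_cons]
    set P := (S.map fun b => (X + C b : ℝ[X])).prod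
    have e0 : ((X + C b) * P).coeff 0 = b * P.coeff 0 := by simp [add_mul]
    have e1 : ((X + C b) * P).coeff 1 = P.coeff 0 + b * P.coeff 1 := by
      simp [add_mul, coeff_X_mul P 0]
    rw [e0, e1]
    refine ⟨by positivity, by positivity, fun s hs => ?_⟩
    obtain ⟨h3, h4⟩ := h2 s hs
    simp only [eval_mul, eval_add, eval_X, eval_C]
    refine ⟨by positivity, ?_⟩
    have e2 : s * (P.coeff 0 + b * P.coeff 1) / (b * P.coeff 0)
        = s / b + s * P.coeff 1 / P.coeff 0 := by
      field_simp
    rw [e2, Real.exp_add]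
    have h5 : s + b ≤ b * Real.exp (s / b) := by
      have := Real.add_one_le_exp (s / b)
      calc s + b = b * (s / b + 1) := by field_simp
        _ ≤ _ := by gcongr
    calc (s + b) * P.eval s ≤ (b * Real.exp (s / b)) *
          (P.coeff 0 * Real.exp (s * P.coeff 1 / P.coeff 0)) := by gcongr
      _ = _ := by ring

open Polynomial in
theorem norm_eval_le_of_roots_neg (f : ℂ[X]) (hf : ∀ z, f.eval z = 0 → z.im = 0 ∧ z.re < 0)
    (s : ℝ) (hs : 0 ≤ s) :
    ‖f.eval (s : ℂ)‖ ≤ ‖f.coeff 0‖ * Real.exp (s * ‖f.coeff 1‖ / ‖f.coeff 0‖) := by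
  have hf0 : f ≠ 0 := by
    rintro rfl
    have := (hf 0 (by simp)).2
    simp at this
  set S : Multiset ℝ := f.roots.map fun z => -z.re with hSdef
  have hS : ∀ b ∈ S, 0 < b := by
    intro b hb
    rw [hSdef, Multiset.mem_map] at hb
    obtain ⟨z, hz, rfl⟩ := hb
    have := (hf z (isRoot_of_mem_roots hz)).2
    linarith
  obtain ⟨h0, h1, h2⟩ := prod_X_add_C_growth S hS
  set P := (S.map fun b => (X + C b : ℝ[X])).prod with hP
  have hfac : f = C f.leadingCoeff * P.map Complex.ofRealHom := by
    conv_lhs => rw [(IsAlgClosed.splits f).eq_prod_roots]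
    congr 1
    rw [hP, hSdef, Polynomial.map_multiset_prod, Multiset.map_map, Multiset.map_map]
    congr 1
    refine Multiset.map_congr rfl fun z hz => ?_
    have := (hf z (isRoot_of_mem_roots hz)).1
    have hz' : ((-z.re : ℝ) : ℂ) = -z := by
      apply Complex.ext <;> simp [this]
    simp only [Function.comp, Polynomial.map_add, map_X, map_C, Complex.ofRealHom_eq_coe, hz']
    simp [sub_eq_add_neg]
  have hlc : 0 < ‖f.leadingCoeff‖ := by simpa using hf0
  have ek : ∀ k, f.coeff k = f.leadingCoeff * (P.coeff k : ℂ) := by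
    intro k
    conv_lhs => rw [hfac]
    simp
  have es : f.eval (s : ℂ) = f.leadingCoeff * ((P.eval s : ℝ) : ℂ) := by
    conv_lhs => rw [hfac]
    rw [eval_mul, eval_C, eval_map, ← Complex.ofRealHom_eq_coe s, eval₂_at_apply]
    simp
  rw [es, ek, ek, norm_mul, norm_mul, norm_mul, Complex.norm_real, Complex.norm_real,
    Complex.norm_real, Real.norm_of_nonneg h0.le, Real.norm_of_nonneg h1,
    Real.norm_of_nonneg (h2 s hs).1]
  have e3 : s * (‖f.leadingCoeff‖ * P.coeff 1) / (‖f.leadingCoeff‖ * P.coeff 0)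
      = s * P.coeff 1 / P.coeff 0 := by
    field_simp
  rw [e3, mul_assoc]
  exact mul_le_mul_of_nonneg_left (h2 s hs).2 hlc.le

-- Gauss–Lucas: a vanishing derivative at 0 would put 0 into the convex hull of roots that all lie
-- in the open left half-plane.
open Polynomial in
theorem coeff_one_ne_zero_of_roots_re_neg (f : ℂ[X]) (hdeg : 0 < f.degree)
    (hf : ∀ z, f.eval z = 0 → z.re < 0) : f.coeff 1 ≠ 0 := by
  intro h
  have hd : f.derivative.eval 0 = 0 := by
    rw [← coeff_zero_eq_eval_zero, coeff_derivative]; simp [h]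
  have hd0 : f.derivative ≠ 0 := by
    intro h'
    have := derivative_eq_zero.1 h'
    rw [← natDegree_pos_iff_degree_pos] at hdeg
    omega
  have h1 : (0 : ℂ) ∈ f.derivative.rootSet ℂ := by
    rw [mem_rootSet, coe_aeval_eq_eval]
    exact ⟨hd0, hd⟩
  have h2 := rootSet_derivative_subset_convexHull_rootSet hdeg h1
  have h3 : convexHull ℝ (f.rootSet ℂ) ⊆ {z : ℂ | z.re < 0} := by
    refine convexHull_min ?_ (convex_halfSpace_re_lt 0)
    intro z hz
    rw [mem_rootSet, coe_aeval_eq_eval] at hz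
    exact hf z hz.2
  have := h3 h2
  simp at this

/-- No zeros in the closed right half-plane, apart from those with all real parts zero. -/
def StronglyStable {n : ℕ} (p : MvPolynomial (Fin n) ℂ) : Prop :=
  ∀ x : Fin n → ℂ, (∀ j, 0 ≤ (x j).re) → (∃ j, 0 < (x j).re) → MvPolynomial.eval x p ≠ 0

open MvPolynomial in
theorem eval_map_finSuccEquiv {n : ℕ} (p : MvPolynomial (Fin (n + 1)) ℂ) (x : Fin n → ℂ) (t : ℂ) :
    ((finSuccEquiv ℂ n p).map (eval x)).eval t = eval (Fin.cons t x) p := by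
  rw [eval_eq_eval_mv_eval']

-- By homogeneity this coefficient is a constant, equal to the value of `p` at (1, 0, …, 0). Strong
-- stability covers this point because it lets some real parts vanish.
open MvPolynomial in
theorem coeff_finSuccEquiv_top_ne_zero {n : ℕ} {p : MvPolynomial (Fin (n + 1)) ℂ}
    (hp : p.IsHomogeneous (n + 1)) (hs : StronglyStable p) (x : Fin n → ℂ) :
    eval x ((finSuccEquiv ℂ n p).coeff (n + 1)) ≠ 0 := by
  have hc : ∀ k, k ≤ n + 1 → ((finSuccEquiv ℂ n p).coeff k).IsHomogeneous (n + 1 - k) := by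
    intro k hk
    exact hp.finSuccEquiv_coeff_isHomogeneous k _ (by omega)
  have h0 := hc (n + 1) le_rfl
  rw [Nat.sub_self] at h0
  have hC := (totalDegree_eq_zero_iff_eq_C.mp (Nat.le_zero.mp h0.totalDegree_le))
  rw [hC, eval_C]
  have hne : eval (Fin.cons 1 (fun _ => 0) : Fin (n + 1) → ℂ) p ≠ 0 := by
    apply hs
    · intro j
      refine Fin.cases ?_ (fun i => ?_) j <;> simp
    · exact ⟨0, by simp⟩
  rw [← eval_map_finSuccEquiv] at hne
  intro hz
  apply hne
  have hdeg : ((finSuccEquiv ℂ n p).map (eval fun _ => (0 : ℂ))).natDegree < n + 2 := by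
    refine lt_of_le_of_lt Polynomial.natDegree_map_le ?_
    rw [natDegree_finSuccEquiv]
    have := degreeOf_le_totalDegree p 0
    have := hp.totalDegree_le
    omega
  rw [Polynomial.eval_eq_sum_range' hdeg]
  refine Finset.sum_eq_zero fun k hk => ?_
  rw [Finset.mem_range] at hk
  rw [Polynomial.coeff_map]
  by_cases hk' : k = n + 1
  · subst hk'
    rw [hC, eval_C, hz, zero_mul]
  · have h1 := hc k (by omega)
    have : eval (fun _ => (0 : ℂ)) ((finSuccEquiv ℂ n p).coeff k) = 0 := by
      have h2 : eval (fun _ => (0 : ℂ)) ((finSuccEquiv ℂ n p).coeff k)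
          = constantCoeff ((finSuccEquiv ℂ n p).coeff k) := by
        rw [← eval_zero]; rfl
      rw [h2, constantCoeff_eq]
      refine h1.coeff_eq_zero (d := 0) ?_
      simp; omega
    rw [this, zero_mul]

-- For admissible x the polynomial in the first variable has all its roots in the open left
-- half-plane, so Gauss–Lucas applies. This keeps the induction on the number of variables going.
open MvPolynomial in
theorem StronglyStable.coeff_one {n : ℕ} {p : MvPolynomial (Fin (n + 1)) ℂ}
    (hp : p.IsHomogeneous (n + 1)) (hs : StronglyStable p) :
    StronglyStable ((finSuccEquiv ℂ n p).coeff 1) := by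
  intro x hx hx'
  have h := coeff_one_ne_zero_of_roots_re_neg ((finSuccEquiv ℂ n p).map (eval x)) ?_ ?_
  · rwa [Polynomial.coeff_map] at h
  · rw [← Polynomial.natDegree_pos_iff_degree_pos]
    refine lt_of_lt_of_le (Nat.succ_pos n) (Polynomial.le_natDegree_of_ne_zero ?_)
    rw [Polynomial.coeff_map]
    exact coeff_finSuccEquiv_top_ne_zero hp hs x
  · intro z hz
    by_contra hz'
    push Not at hz'
    rw [eval_map_finSuccEquiv] at hz
    obtain ⟨j, hj⟩ := hx'
    refine hs _ ?_ ⟨j.succ, by simpa using hj⟩ hz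
    intro i
    refine Fin.cases ?_ (fun i => ?_) i
    · simpa using hz'
    · simpa using hx i

open MvPolynomial in
theorem eval_smul_of_isHomogeneous {n k : ℕ} {p : MvPolynomial (Fin n) ℂ}
    (hp : p.IsHomogeneous k) (l : ℂ) (x : Fin n → ℂ) : eval (l • x) p = l ^ k * eval x p := by
  rw [eval_eq', eval_eq', Finset.mul_sum]
  refine Finset.sum_congr rfl fun d hd => ?_
  have h1 : ∑ i, d i = k := by
    have h2 := hp (mem_support_iff.1 hd)
    rw [← h2, Finsupp.weight_apply, Finsupp.sum_fintype]
    · simp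
    · simp
  simp only [Pi.smul_apply, smul_eq_mul, mul_pow, Finset.prod_mul_distrib]
  rw [Finset.prod_pow_eq_pow_sum, h1]
  ring

-- Homogeneity lets a zero be multiplied by any scalar l. Unless the root z is a negative real, some
-- l with positive real part also makes Re(lz) nonnegative, which contradicts strong stability.
open MvPolynomial in
theorem StronglyStable.real_rooted {n : ℕ} (hn : 0 < n) {p : MvPolynomial (Fin (n + 1)) ℂ}
    (hp : p.IsHomogeneous (n + 1)) (hs : StronglyStable p) (x : Fin n → ℝ) (hx : ∀ j, 0 < x j)
    (z : ℂ) (hz : ((finSuccEquiv ℂ n p).map (eval fun j => (x j : ℂ))).eval z = 0) :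
    z.im = 0 ∧ z.re < 0 := by
  by_contra hcon
  rw [eval_map_finSuccEquiv] at hz
  have key : ∀ l : ℂ, 0 < l.re → 0 ≤ (l * z).re → False := by
    intro l hl hlz
    refine hs (l • (Fin.cons z fun j => (x j : ℂ)) : Fin (n + 1) → ℂ) ?_ ?_ ?_
    · intro i
      refine Fin.cases ?_ (fun i => ?_) i
      · simpa using hlz
      · have := hx i
        simp only [Pi.smul_apply, Fin.cons_succ, smul_eq_mul, Complex.re_mul_ofReal]
        positivity
    · refine ⟨Fin.succ ⟨0, hn⟩, ?_⟩
      have := hx ⟨0, hn⟩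
      simp only [Pi.smul_apply, Fin.cons_succ, smul_eq_mul, Complex.re_mul_ofReal]
      positivity
    · rw [eval_smul_of_isHomogeneous hp, hz, mul_zero]
  by_cases hre : 0 ≤ z.re
  · exact key 1 (by simp) (by simpa using hre)
  · push Not at hre
    have him : z.im ≠ 0 := fun h => hcon ⟨h, hre⟩
    have hlt : |z.re| < ‖z‖ := Complex.abs_re_lt_norm.2 him
    -- This l points along the bisector of 1 and the conjugate of z, so that l and lz both have
    -- nonnegative real part; it is nonzero since z is not real.
    refine key ((‖z‖ : ℂ) + (starRingEnd ℂ) z) ?_ ?_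
    · have := neg_abs_le z.re
      simp; linarith
    · have : ((‖z‖ : ℂ) + (starRingEnd ℂ) z) * z = ‖z‖ * (z + ‖z‖) := by
        rw [add_mul, mul_comm ((starRingEnd ℂ) z) z, Complex.mul_conj, Complex.normSq_eq_norm_sq]
        push_cast; ring
      rw [this, Complex.re_ofReal_mul]
      have := neg_abs_le z.re
      refine mul_nonneg (norm_nonneg _) ?_
      simp; linarith

-- Gurvits's step: passing to the coefficient of the first power of one variable costs at most a
-- factor e in capacity. The growth bound for real-rooted polynomials is used at the point s where
-- its exponent equals 1.
open MvPolynomial in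
theorem StronglyStable.capacity_coeff_one {n : ℕ} (hn : 0 < n)
    {p : MvPolynomial (Fin (n + 1)) ℂ} (hp : p.IsHomogeneous (n + 1)) (hs : StronglyStable p)
    {c : ℝ}
    (hcap : ∀ x : Fin (n + 1) → ℝ, (∀ j, 0 < x j) → c * ∏ j, x j ≤ ‖eval (fun j => (x j : ℂ)) p‖)
    (x : Fin n → ℝ) (hx : ∀ j, 0 < x j) :
    c * Real.exp (-1) * ∏ j, x j ≤ ‖eval (fun j => (x j : ℂ)) ((finSuccEquiv ℂ n p).coeff 1)‖ := by
  have hxre : ∀ j, 0 ≤ ((fun j => (x j : ℂ)) j).re := fun j => by simpa using (hx j).le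
  have hxre' : ∃ j, 0 < ((fun j => (x j : ℂ)) j).re := ⟨⟨0, hn⟩, by simpa using hx _⟩
  set f := (finSuccEquiv ℂ n p).map (eval fun j => (x j : ℂ)) with hf
  have hroots := hs.real_rooted hn hp x hx
  have h1 : 0 < ‖f.coeff 1‖ := by
    rw [hf, Polynomial.coeff_map, norm_pos_iff]
    exact hs.coeff_one hp _ hxre hxre'
  have h0 : 0 < ‖f.coeff 0‖ := by
    rw [norm_pos_iff, Polynomial.coeff_zero_eq_eval_zero]
    intro h
    have := (hroots 0 h).2
    simp at this
  set s : ℝ := ‖f.coeff 0‖ / ‖f.coeff 1‖ with hsdef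
  have hspos : 0 < s := by positivity
  have hb := norm_eval_le_of_roots_neg f hroots s hspos.le
  have e1 : s * ‖f.coeff 1‖ / ‖f.coeff 0‖ = 1 := by
    rw [hsdef]; field_simp
  rw [e1, hf, eval_map_finSuccEquiv, ← hf] at hb
  have hc := hcap (Fin.cons s x) fun j => by
    refine Fin.cases ?_ (fun i => ?_) j
    · simpa using hspos
    · simpa using hx i
  have e2 : (fun j => (((Fin.cons s x : Fin (n + 1) → ℝ) j : ℝ) : ℂ))
      = Fin.cons (s : ℂ) (fun j => (x j : ℂ)) := by
    funext j
    refine Fin.cases ?_ (fun i => ?_) j <;> simp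
  rw [e2, Fin.prod_univ_succ] at hc
  simp only [Fin.cons_zero, Fin.cons_succ] at hc
  have h2 := hc.trans hb
  rw [← Polynomial.coeff_map, ← hf]
  have e3 : ‖f.coeff 0‖ = s * ‖f.coeff 1‖ := by
    rw [hsdef]; field_simp
  rw [e3] at h2
  have h3 : c * ∏ j, x j ≤ ‖f.coeff 1‖ * Real.exp 1 := by
    refine le_of_mul_le_mul_left ?_ hspos
    calc _ = c * (s * ∏ j, x j) := by ring
      _ ≤ _ := h2
      _ = _ := by ring
  rw [Real.exp_neg]
  have := Real.exp_pos 1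
  calc c * (Real.exp 1)⁻¹ * ∏ j, x j = (c * ∏ j, x j) * (Real.exp 1)⁻¹ := by ring
    _ ≤ (‖f.coeff 1‖ * Real.exp 1) * (Real.exp 1)⁻¹ := by gcongr
    _ = _ := by field_simp

-- One factor e is lost per eliminated variable. The last variable costs nothing, as a linear form
-- in it is its own coefficient, hence the exponent `n` for `n + 1` variables.
open MvPolynomial in
theorem StronglyStable.capacity_le_coeff (n : ℕ) :
    ∀ (p : MvPolynomial (Fin (n + 1)) ℂ), p.IsHomogeneous (n + 1) → StronglyStable p →
    ∀ c : ℝ, (∀ x : Fin (n + 1) → ℝ, (∀ j, 0 < x j) →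
      c * ∏ j, x j ≤ ‖eval (fun j => (x j : ℂ)) p‖) →
    c * Real.exp (-n) ≤ ‖coeff (Finsupp.equivFunOnFinite.symm fun _ => 1) p‖ := by
  induction n with
  | zero =>
    intro p hp _ c hcap
    have h := hcap (fun _ => 1) (fun _ => one_pos)
    have e : eval (fun _ => ((1 : ℝ) : ℂ)) p
        = coeff (Finsupp.equivFunOnFinite.symm fun _ => 1) p := by
      rw [eval_eq']
      simp only [Complex.ofReal_one, one_pow, Finset.prod_const_one, mul_one]
      refine Finset.sum_eq_single _ (fun d hd hne => ?_) (fun h => notMem_support_iff.1 h)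
      exfalso
      apply hne
      have h2 := hp (mem_support_iff.1 hd)
      rw [Finsupp.weight_apply, Finsupp.sum_fintype _ _ (by simp)] at h2
      ext j
      have hj : j = 0 := Fin.fin_one_eq_zero j
      subst hj
      simpa using h2
    rw [e] at h
    simpa using h
  | succ n ih =>
    intro p hp hs c hcap
    have h := ih ((finSuccEquiv ℂ (n + 1) p).coeff 1)
      (hp.finSuccEquiv_coeff_isHomogeneous 1 (n + 1) (by omega)) (hs.coeff_one hp)
      (c * Real.exp (-1)) (hs.capacity_coeff_one (Nat.succ_pos n) hp hcap)
    rw [finSuccEquiv_coeff_coeff] at h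
    have e : Finsupp.cons 1 (Finsupp.equivFunOnFinite.symm fun _ => 1)
        = (Finsupp.equivFunOnFinite.symm fun _ => 1 : Fin (n + 1 + 1) →₀ ℕ) := by
      ext j
      refine Fin.cases ?_ (fun i => ?_) j <;> simp
    rw [e] at h
    refine le_trans (le_of_eq ?_) h
    rw [mul_assoc, ← Real.exp_add]
    congr 2
    push_cast
    ring

open MvPolynomial in
theorem coeff_prod_linear {n : ℕ} (A : Matrix (Fin n) (Fin n) ℂ) :
    coeff (Finsupp.equivFunOnFinite.symm fun _ => 1) (∏ i, ∑ j, C (A i j) * X j)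
      = Matrix.permanent A := by
  classical
  rw [Finset.prod_univ_sum, coeff_sum]
  simp only [Finset.prod_mul_distrib]
  have key : ∀ φ : Fin n → Fin n,
      coeff (Finsupp.equivFunOnFinite.symm fun _ => 1)
        ((∏ i, C (A i (φ i))) * ∏ i, (X (φ i) : MvPolynomial (Fin n) ℂ))
      = if Function.Bijective φ then ∏ i, A i (φ i) else 0 := by
    intro φ
    have e1 : ∏ i, (X (φ i) : MvPolynomial (Fin n) ℂ)
        = monomial (∑ i, Finsupp.single (φ i) 1) 1 := by
      rw [monomial_sum_one]; rfl
    rw [← map_prod, coeff_C_mul, e1, coeff_monomial]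
    have e2 : (∑ i, Finsupp.single (φ i) 1 = (Finsupp.equivFunOnFinite.symm fun _ => 1 : Fin n →₀ ℕ))
        ↔ Function.Bijective φ := by
      have e3 : ∀ j, (∑ i, Finsupp.single (φ i) 1 : Fin n →₀ ℕ) j
          = (Finset.univ.filter fun i => φ i = j).card := by
        intro j
        rw [Finsupp.finsetSum_apply, Finset.card_filter]
        simp [Finsupp.single_apply]
      constructor
      · intro h
        rw [Function.bijective_iff_existsUnique]
        intro j
        have h1 := DFunLike.congr_fun h j
        rw [e3] at h1
        simp only [Finsupp.coe_equivFunOnFinite_symm] at h1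
        obtain ⟨a, ha⟩ := Finset.card_eq_one.1 h1
        refine ⟨a, ?_, fun b hb => ?_⟩
        · have : a ∈ Finset.univ.filter fun i => φ i = j := by rw [ha]; simp
          simpa using this
        · have : b ∈ Finset.univ.filter fun i => φ i = j := by simpa using hb
          rw [ha] at this
          simpa using this
      · intro h
        ext j
        rw [e3]
        simp only [Finsupp.coe_equivFunOnFinite_symm]
        rw [Finset.card_eq_one]
        obtain ⟨a, ha, ha'⟩ := (Function.bijective_iff_existsUnique φ).1 h j
        exact ⟨a, by ext b; simpa using ⟨ha' b, fun h => h ▸ ha⟩⟩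
    simp [e2]
  rw [Fintype.piFinset_univ, Finset.sum_congr rfl fun φ _ => key φ, ← Finset.sum_filter,
    ← Matrix.permanent_transpose, Matrix.permanent]
  refine Finset.sum_bij' (fun φ hφ => Equiv.ofBijective φ (Finset.mem_filter.1 hφ).2)
    (fun σ _ => σ) ?_ ?_ ?_ ?_ ?_
  · simp
  · exact fun σ _ => Finset.mem_filter.2 ⟨Finset.mem_univ _, σ.bijective⟩
  · intro φ _; rfl
  · intro σ _; ext; rfl
  · intro φ _; simp

-- The product of the row forms has the permanent as its multilinear coefficient. Positive entries
-- make it strongly stable; weighted AM–GM on the rows, followed by the column sums, makes its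
-- capacity at least 1.
open MvPolynomial in
theorem exp_neg_le_permanent_of_pos {n : ℕ} (A : Matrix (Fin n) (Fin n) ℝ)
    (hpos : ∀ i j, 0 < A i j) (hrow : ∀ i, ∑ j, A i j = 1) (hcol : ∀ j, ∑ i, A i j = 1) :
    Real.exp (-n) ≤ A.permanent := by
  obtain _ | n := n
  · simp [Matrix.permanent_isEmpty]
  set p : MvPolynomial (Fin (n + 1)) ℂ := ∏ i, ∑ j, C ((A i j : ℝ) : ℂ) * X j with hp
  have hev : ∀ x, eval x p = ∏ i, ∑ j, (A i j : ℂ) * x j := by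
    intro x; simp [hp]
  have hhom : p.IsHomogeneous (n + 1) := by
    have := IsHomogeneous.prod Finset.univ
      (fun i : Fin (n + 1) => ∑ j, C ((A i j : ℝ) : ℂ) * X j) (fun _ => 1) fun i _ => by
        refine IsHomogeneous.sum _ _ _ fun j _ => ?_
        simpa using (isHomogeneous_C _ ((A i j : ℝ) : ℂ)).mul (isHomogeneous_X _ j)
    simpa using this
  have hst : StronglyStable p := by
    rintro x hx ⟨k, hk⟩
    rw [hev, Finset.prod_ne_zero_iff]
    intro i _ h
    have h1 : 0 < (∑ j, (A i j : ℂ) * x j).re := by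
      rw [Complex.re_sum]
      refine Finset.sum_pos' (fun j _ => ?_) ⟨k, Finset.mem_univ _, ?_⟩
      · rw [Complex.re_ofReal_mul]; exact mul_nonneg (hpos i j).le (hx j)
      · rw [Complex.re_ofReal_mul]; exact mul_pos (hpos i k) hk
    rw [h] at h1
    simp at h1
  have hcap : ∀ x : Fin (n + 1) → ℝ, (∀ j, 0 < x j) →
      1 * ∏ j, x j ≤ ‖eval (fun j => (x j : ℂ)) p‖ := by
    intro x hx
    have e1 : eval (fun j => (x j : ℂ)) p = ((∏ i, ∑ j, A i j * x j : ℝ) : ℂ) := by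
      rw [hev]; push_cast; rfl
    have h1 : ∀ i, ∏ j, x j ^ A i j ≤ ∑ j, A i j * x j := fun i =>
      Real.geom_mean_le_arith_mean_weighted _ _ _ (fun j _ => (hpos i j).le) (hrow i)
        fun j _ => (hx j).le
    rw [e1, Complex.norm_real, one_mul]
    refine le_trans ?_ (Real.le_norm_self _)
    calc ∏ j, x j = ∏ j, ∏ i, x j ^ A i j := by
          refine Finset.prod_congr rfl fun j _ => ?_
          rw [← Real.rpow_sum_of_pos (hx j), hcol, Real.rpow_one]
      _ = ∏ i, ∏ j, x j ^ A i j := Finset.prod_comm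
      _ ≤ _ := Finset.prod_le_prod
          (fun i _ => Finset.prod_nonneg fun j _ => Real.rpow_nonneg (hx j).le _) fun i _ => h1 i
  have h := StronglyStable.capacity_le_coeff n p hhom hst 1 hcap
  rw [hp, coeff_prod_linear (fun i j => ((A i j : ℝ) : ℂ))] at h
  have e2 : Matrix.permanent (fun i j => ((A i j : ℝ) : ℂ)) = ((A.permanent : ℝ) : ℂ) := by
    simp [Matrix.permanent]
  have h0 : 0 ≤ A.permanent :=
    Finset.sum_nonneg fun σ _ => Finset.prod_nonneg fun i _ => (hpos _ _).le
  rw [e2, Complex.norm_real, Real.norm_of_nonneg h0, one_mul] at h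
  refine le_trans (Real.exp_le_exp.2 ?_) h
  push_cast
  linarith

theorem exp_neg_le_permanent_fin {n : ℕ} (A : Matrix (Fin n) (Fin n) ℝ)
    (hnn : ∀ i j, 0 ≤ A i j) (hrow : ∀ i, ∑ j, A i j = 1) (hcol : ∀ j, ∑ i, A i j = 1) :
    Real.exp (-n) ≤ A.permanent := by
  obtain _ | n := n
  · simp [Matrix.permanent_isEmpty]
  -- Mixing with the uniform matrix makes all entries positive; the permanent is continuous, so the
  -- mixing weight can tend to 0.
  set F : ℝ → Matrix (Fin (n + 1)) (Fin (n + 1)) ℝ :=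
    fun e i j => (1 - e) * A i j + e * ((n : ℝ) + 1)⁻¹ with hF
  have hcont : Tendsto (fun e => (F e).permanent) (𝓝[>] 0) (𝓝 (F 0).permanent) := by
    have : Continuous fun e => (F e).permanent := by
      unfold Matrix.permanent
      simp only [hF]
      fun_prop
    exact this.continuousWithinAt
  have h0 : F 0 = A := by funext i j; simp [hF]
  rw [h0] at hcont
  refine ge_of_tendsto hcont ?_
  filter_upwards [Ioo_mem_nhdsGT (show (0 : ℝ) < 1 by norm_num)] with e he
  have he0 := he.1
  have he1 := he.2
  have hc : ((n : ℝ) + 1) * ((n : ℝ) + 1)⁻¹ = 1 := by field_simp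
  refine exp_neg_le_permanent_of_pos (F e) (fun i j => ?_) (fun i => ?_) (fun j => ?_)
  · have h1 := hnn i j
    have h2 : 0 < 1 - e := by linarith
    simp only [hF]; positivity
  · simp only [hF, Finset.sum_add_distrib, ← Finset.mul_sum, hrow, Finset.sum_const,
      Finset.card_univ, Fintype.card_fin, nsmul_eq_mul]
    push_cast
    rw [hc]; ring
  · simp only [hF, Finset.sum_add_distrib, ← Finset.mul_sum, hcol, Finset.sum_const,
      Finset.card_univ, Fintype.card_fin, nsmul_eq_mul]
    push_cast
    rw [hc]; ring

/-- A doubly stochastic matrix has permanent at least `e⁻ⁿ`. -/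
theorem exp_neg_card_le_permanent {ι : Type*} [Fintype ι] [DecidableEq ι] (A : Matrix ι ι ℝ)
    (hnn : ∀ i j, 0 ≤ A i j) (hrow : ∀ i, ∑ j, A i j = 1) (hcol : ∀ j, ∑ i, A i j = 1) :
    Real.exp (-Fintype.card ι) ≤ A.permanent := by
  set e := Fintype.equivFin ι
  have h := exp_neg_le_permanent_fin (fun i j => A (e.symm i) (e.symm j)) (fun i j => hnn _ _)
    (fun i => by rw [← hrow (e.symm i)]; exact Equiv.sum_comp e.symm fun j => A (e.symm i) j)
    (fun j => by rw [← hcol (e.symm j)]; exact Equiv.sum_comp e.symm fun i => A i (e.symm j))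
  refine h.trans (le_of_eq ?_)
  unfold Matrix.permanent
  refine Fintype.sum_equiv (e.permCongr.symm) _ _ fun σ => ?_
  refine Fintype.prod_equiv e.symm _ _ fun i => ?_
  simp [Equiv.permCongr]

end Permanent

/-! ### Substochastic matrices bordered by dummy points. -/

section Augmented

variable {V : Type u} [Fintype V] [DecidableEq V]

/-- A substochastic matrix with few missing mass supports many permutations of the vertex set
enlarged by `t` dummy points, all of whose arcs between genuine points lie in the support. -/
theorem exp_neg_le_card_perm_mul (w : V → V → ℝ) (t : ℕ) (ht : 0 < t) (W : ℝ) (hW1 : W ≤ 1)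
    (hnn : ∀ u v, 0 ≤ w u v) (hrow : ∀ u, ∑ v, w u v ≤ 1) (hcol : ∀ v, ∑ u, w u v ≤ 1)
    (hW : ∀ u v, w u v ≤ W) (hW0 : 0 < W) (htot : (Fintype.card V : ℝ) - t ≤ ∑ u, ∑ v, w u v) :
    Real.exp (-(Fintype.card V + t : ℕ)) ≤
      (Nat.card {π : Equiv.Perm (V ⊕ Fin t) //
        ∀ u v, π (Sum.inl u) = Sum.inl v → 0 < w u v} : ℝ) * W ^ (Fintype.card V - t) := by
  classical
  set n := Fintype.card V with hn
  have htR : (0 : ℝ) < t := by exact_mod_cast ht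
  have ht1 : (1 : ℝ) ≤ t := by exact_mod_cast ht
  set T := ∑ u, ∑ v, w u v with hT
  have hT' : ∑ v, ∑ u, w u v = T := Finset.sum_comm
  have hTn : T ≤ n := by
    calc T ≤ ∑ u : V, (1 : ℝ) := Finset.sum_le_sum fun u _ => hrow u
      _ = n := by simp [hn]
  have hT0 : 0 ≤ T := Finset.sum_nonneg fun u _ => Finset.sum_nonneg fun v _ => hnn u v
  -- The deficit of every row and column is spread evenly over the `t` dummies, so each dummy
  -- receives `q` from the vertices. The hypothesis on the total mass says that `q ≤ 1`, which
  -- leaves 1 - q ≥ 0 for the dummy block.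
  set q : ℝ := (n - T) / t with hq
  have hq0 : 0 ≤ q := div_nonneg (by linarith) htR.le
  have hq1 : q ≤ 1 := (div_le_one htR).2 (by linarith)
  let B : Matrix (V ⊕ Fin t) (V ⊕ Fin t) ℝ := Matrix.fromBlocks (fun u v => w u v)
    (fun u _ => (1 - ∑ v, w u v) / t) (fun _ v => (1 - ∑ u, w u v) / t) (fun _ _ => (1 - q) / t)
  have b11 : ∀ u v, B (Sum.inl u) (Sum.inl v) = w u v := fun _ _ => rfl
  have b12 : ∀ u k, B (Sum.inl u) (Sum.inr k) = (1 - ∑ v, w u v) / t := fun _ _ => rfl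
  have b21 : ∀ k v, B (Sum.inr k) (Sum.inl v) = (1 - ∑ u, w u v) / t := fun _ _ => rfl
  have b22 : ∀ k j, B (Sum.inr k) (Sum.inr j) = (1 - q) / t := fun _ _ => rfl
  have hsub : ∀ x : ℝ, 0 ≤ x → x ≤ 1 → 0 ≤ (1 - x) / t ∧ (1 - x) / t ≤ 1 := by
    intro x h0 h1
    refine ⟨div_nonneg (by linarith) htR.le, (div_le_one htR).2 (by linarith)⟩
  have hr0 : ∀ u, 0 ≤ ∑ v, w u v := fun u => Finset.sum_nonneg fun v _ => hnn u v
  have hc0 : ∀ v, 0 ≤ ∑ u, w u v := fun v => Finset.sum_nonneg fun u _ => hnn u v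
  have hB0 : ∀ x y, 0 ≤ B x y := by
    rintro (u | i) (v | j)
    · exact hnn u v
    · exact (hsub _ (hr0 u) (hrow u)).1
    · exact (hsub _ (hc0 v) (hcol v)).1
    · exact (hsub _ hq0 hq1).1
  have hsum1 : ∑ u, (1 - ∑ v, w u v) / (t : ℝ) = q := by
    rw [← Finset.sum_div, Finset.sum_sub_distrib]; simp [hq, hn, hT]
  have hsum2 : ∑ v, (1 - ∑ u, w u v) / (t : ℝ) = q := by
    rw [← Finset.sum_div, Finset.sum_sub_distrib, hT']; simp [hq, hn]
  have hBrow : ∀ x, ∑ y, B x y = 1 := by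
    rintro (u | i)
    · simp only [Fintype.sum_sum_type, b11, b12,
        Finset.sum_const, Finset.card_univ, Fintype.card_fin, nsmul_eq_mul]
      field_simp; ring
    · simp only [Fintype.sum_sum_type, b21, b22,
        Finset.sum_const, Finset.card_univ, Fintype.card_fin, nsmul_eq_mul, hsum2]
      field_simp; ring
  have hBcol : ∀ y, ∑ x, B x y = 1 := by
    rintro (u | i)
    · simp only [Fintype.sum_sum_type, b11, b21,
        Finset.sum_const, Finset.card_univ, Fintype.card_fin, nsmul_eq_mul]
      field_simp; ring
    · simp only [Fintype.sum_sum_type, b12, b22,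
        Finset.sum_const, Finset.card_univ, Fintype.card_fin, nsmul_eq_mul, hsum1]
      field_simp; ring
  have hper := exp_neg_card_le_permanent B hB0 hBrow hBcol
  rw [Fintype.card_sum, Fintype.card_fin] at hper
  refine hper.trans ?_
  rw [← Matrix.permanent_transpose, Matrix.permanent]
  simp only [Matrix.transpose_apply]
  set S := Finset.univ.filter fun π : Equiv.Perm (V ⊕ Fin t) =>
    ∀ u v, π (Sum.inl u) = Sum.inl v → 0 < w u v with hS
  have hcard : (Nat.card {π : Equiv.Perm (V ⊕ Fin t) //
        ∀ u v, π (Sum.inl u) = Sum.inl v → 0 < w u v} : ℝ) = S.card := by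
    rw [Nat.card_eq_fintype_card, Fintype.card_subtype]
  rw [hcard, ← nsmul_eq_mul, ← Finset.sum_const]
  rw [← Finset.sum_subset (Finset.subset_univ S)]
  · refine Finset.sum_le_sum fun π _ => ?_
    rw [Fintype.prod_sum_type]
    have h1 : ∏ i : Fin t, B (Sum.inr i) (π (Sum.inr i)) ≤ 1 := by
      refine Finset.prod_le_one (fun i _ => hB0 _ _) fun i _ => ?_
      rcases π (Sum.inr i) with v | j
      · exact (hsub _ (hc0 v) (hcol v)).2
      · exact (hsub _ hq0 hq1).2
    -- At most `t` vertices go to dummies. The other n - t contribute at most `W` each, and every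
    -- remaining entry of `B` is at most 1.
    have h2 : ∏ u, B (Sum.inl u) (π (Sum.inl u)) ≤ W ^ (n - t) := by
      set D := Finset.univ.filter fun u : V => (π (Sum.inl u)).isLeft with hD
      have hDc : n - t ≤ D.card := by
        have h3 : (Finset.univ.filter fun u : V => ¬ (π (Sum.inl u)).isLeft).card ≤ t := by
          have : (Finset.univ.filter fun u : V => ¬ (π (Sum.inl u)).isLeft).card
              ≤ ((Finset.univ : Finset (Fin t)).map
                ⟨fun k => (Sum.inr k : V ⊕ Fin t), Sum.inr_injective⟩).card := by
            refine Finset.card_le_card_of_injOn (fun u => π (Sum.inl u)) ?_ ?_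
            · intro u hu
              simp only [Finset.coe_filter, Finset.mem_univ, true_and, Set.mem_ofPred_eq] at hu
              rcases h : π (Sum.inl u) with v | j
              · simp [h] at hu
              · simp only [Finset.coe_map, Finset.coe_univ, Set.image_univ, Set.mem_range,
                  Function.Embedding.coeFn_mk]
                exact ⟨j, h.symm⟩
            · intro u _ v _ h
              simpa using h
          simpa using this
        have h4 := Finset.card_filter_add_card_filter_not (s := (Finset.univ : Finset V))
          (fun u : V => ((π (Sum.inl u)).isLeft : Prop))
        rw [Finset.card_univ, ← hn, ← hD] at h4
        omega
      calc ∏ u, B (Sum.inl u) (π (Sum.inl u))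
          ≤ ∏ u, if (π (Sum.inl u)).isLeft then W else 1 := by
            refine Finset.prod_le_prod (fun u _ => hB0 _ _) fun u _ => ?_
            rcases h : π (Sum.inl u) with v | j
            · simpa [b11] using hW u v
            · simpa [b12] using (hsub _ (hr0 u) (hrow u)).2
        _ = W ^ D.card := by
            rw [Finset.prod_ite]; simp [hD]
        _ ≤ W ^ (n - t) := pow_le_pow_of_le_one hW0.le hW1 hDc
    calc _ ≤ W ^ (n - t) * 1 := by
          refine mul_le_mul h2 h1 (Finset.prod_nonneg fun i _ => hB0 _ _) (by positivity)
      _ = _ := mul_one _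
  · intro π _ hπ
    simp only [hS, Finset.mem_filter, Finset.mem_univ, true_and, not_forall] at hπ
    obtain ⟨u, v, h, hw⟩ := hπ
    refine Finset.prod_eq_zero (Finset.mem_univ (Sum.inl u)) ?_
    rw [h]
    exact le_antisymm (not_lt.1 hw) (hnn u v)

end Augmented

/-! ### Random layerings and the second moment method. -/

section Layering

variable {V : Type u}

/-- Resampling one coordinate of a uniformly random function. -/
theorem card_mul_sum_eq_sum_update [Fintype V] [DecidableEq V] {A : Type*} [Fintype A] (Φ : (V → A) → ℝ) (v : V) :
    (Fintype.card A : ℝ) * ∑ f, Φ f = ∑ f : V → A, ∑ a, Φ (Function.update f v a) := by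
  classical
  have h1 : (Fintype.card A : ℝ) * ∑ f, Φ f = ∑ p : (V → A) × A, Φ p.1 := by
    rw [Fintype.sum_prod_type]
    simp [Finset.mul_sum]
  rw [h1, ← Fintype.sum_prod_type (fun p : (V → A) × A => Φ (Function.update p.1 v p.2))]
  refine Finset.sum_bij' (fun p _ => (Function.update p.1 v p.2, p.1 v))
    (fun p _ => (Function.update p.1 v p.2, p.1 v)) ?_ ?_ ?_ ?_ ?_
  all_goals simp

/-- The indicator that `f` places `v` in the layer following that of `u`. -/
def layerStep {m : ℕ} (f : V → Fin m) (u v : V) : ℝ :=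
  if (f u : ℕ) + 1 = f v then 1 else 0

theorem layerStep_nonneg {m : ℕ} (f : V → Fin m) (u v : V) : 0 ≤ layerStep f u v := by
  unfold layerStep; split_ifs <;> norm_num

theorem layerStep_sq {m : ℕ} (f : V → Fin m) (u v : V) :
    layerStep f u v * layerStep f u v = layerStep f u v := by
  unfold layerStep; split_ifs <;> norm_num

theorem sum_layerStep_update_right [DecidableEq V] {m : ℕ} (f : V → Fin m) {u v : V} (h : u ≠ v) :
    ∑ a, layerStep (Function.update f v a) u v = if (f u : ℕ) + 1 < m then 1 else 0 := by
  unfold layerStep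
  simp only [Function.update_self, Function.update_of_ne h]
  split_ifs with h1
  · rw [Finset.sum_eq_single ⟨(f u : ℕ) + 1, h1⟩]
    · simp
    · intro b _ hb
      rw [if_neg]
      intro h2
      exact hb (Fin.ext h2.symm)
    · simp
  · refine Finset.sum_eq_zero fun a _ => if_neg fun h2 => h1 ?_
    rw [h2]; exact a.2

theorem sum_layerStep_update_left_le [DecidableEq V] {m : ℕ} (f : V → Fin m) {u v : V} (h : u ≠ v) :
    ∑ a, layerStep (Function.update f u a) u v ≤ 1 := by
  unfold layerStep
  simp only [Function.update_self, Function.update_of_ne h.symm]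
  rw [← Finset.sum_filter, Finset.sum_const, nsmul_eq_mul, mul_one]
  have : (Finset.univ.filter fun a : Fin m => (a : ℕ) + 1 = f v).card ≤ 1 := by
    rw [Finset.card_le_one]
    intro a ha b hb
    simp only [Finset.mem_filter, Finset.mem_univ, true_and] at ha hb
    exact Fin.ext (by omega)
  exact_mod_cast this

theorem sum_layerStep [Fintype V] [DecidableEq V] {m : ℕ} {u v : V} (h : u ≠ v) :
    (m : ℝ) ^ 2 * ∑ f : V → Fin m, layerStep f u v = (m : ℝ) ^ Fintype.card V * (m - 1) := by
  have h1 := card_mul_sum_eq_sum_update (fun f : V → Fin m => layerStep f u v) v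
  have h2 := card_mul_sum_eq_sum_update
    (fun f : V → Fin m => if (f u : ℕ) + 1 < m then (1 : ℝ) else 0) u
  simp only [Fintype.card_fin, sum_layerStep_update_right _ h, Function.update_self] at h1 h2
  rw [sq, mul_assoc, h1, h2]
  have h3 : ∑ a : Fin m, (if (a : ℕ) + 1 < m then (1 : ℝ) else 0) = m - 1 ∨ m = 0 := by
    obtain _ | m := m
    · exact Or.inr rfl
    · left
      rw [Fin.sum_univ_castSucc]
      simp
  rcases h3 with h3 | h3
  · rw [h3]; simp; ring
  · subst h3
    have : Nonempty V := ⟨u⟩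
    simp

theorem sum_layerStep_le [Fintype V] [DecidableEq V] {m : ℕ} {u v : V} (h : u ≠ v) :
    (m : ℝ) * ∑ f : V → Fin m, layerStep f u v ≤ (m : ℝ) ^ Fintype.card V := by
  have h1 := card_mul_sum_eq_sum_update (fun f : V → Fin m => layerStep f u v) v
  simp only [Fintype.card_fin, sum_layerStep_update_right _ h] at h1
  rw [h1]
  calc _ ≤ ∑ f : V → Fin m, (1 : ℝ) := Finset.sum_le_sum fun f _ => by split_ifs <;> norm_num
    _ = _ := by simp

/-- Resampling the layer of `v` alone leaves the arc from `u` to `v'` untouched and hits the right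
layer with probability at most 1/m. Hence distinct arcs at a common tail occur together with
probability at most 1/m². -/
theorem sum_layerStep_mul_out_le [Fintype V] [DecidableEq V] {m : ℕ} {u v v' : V} (h : u ≠ v) (h' : u ≠ v') (hv : v ≠ v') :
    (m : ℝ) ^ 2 * ∑ f : V → Fin m, layerStep f u v * layerStep f u v'
      ≤ (m : ℝ) ^ Fintype.card V := by
  have h1 := card_mul_sum_eq_sum_update
    (fun f : V → Fin m => layerStep f u v * layerStep f u v') v
  have h2 : ∀ (f : V → Fin m) a, layerStep (Function.update f v a) u v' = layerStep f u v' := by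
    intro f a
    simp [layerStep, Function.update_of_ne h, Function.update_of_ne hv.symm]
  simp only [h2, Fintype.card_fin, ← Finset.sum_mul, sum_layerStep_update_right _ h] at h1
  rw [sq, mul_assoc, h1]
  refine le_trans ?_ (sum_layerStep_le h')
  gcongr with f
  have := layerStep_nonneg f u v'
  split_ifs <;> simp [this]

theorem sum_layerStep_mul_in_le [Fintype V] [DecidableEq V] {m : ℕ} {u u' v : V} (h : u ≠ v) (h' : u' ≠ v) (hu : u ≠ u') :
    (m : ℝ) ^ 2 * ∑ f : V → Fin m, layerStep f u v * layerStep f u' v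
      ≤ (m : ℝ) ^ Fintype.card V := by
  have h1 := card_mul_sum_eq_sum_update
    (fun f : V → Fin m => layerStep f u v * layerStep f u' v) u
  have h2 : ∀ (f : V → Fin m) a, layerStep (Function.update f u a) u' v = layerStep f u' v := by
    intro f a
    simp [layerStep, Function.update_of_ne h.symm, Function.update_of_ne hu.symm]
  simp only [h2, Fintype.card_fin, ← Finset.sum_mul] at h1
  rw [sq, mul_assoc, h1]
  refine le_trans ?_ (sum_layerStep_le h')
  gcongr with f
  exact mul_le_of_le_one_left (layerStep_nonneg _ _ _) (sum_layerStep_update_left_le f h)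

/-- Second moment bound for a weighted sum of nearly uncorrelated indicators. -/
theorem sum_sq_sub_le {Ω ι : Type*} [Fintype Ω] [Fintype ι] [DecidableEq ι] (a : ι → ℝ)
    (J : Ω → ι → ℝ) (m W M : ℝ) (hm : 0 < m) (hW0 : 0 ≤ W) (hM : 0 ≤ M) (hMc : M = Fintype.card Ω)
    (ha : ∀ i, 0 ≤ a i) (haW : ∀ i, a i ≤ W) (hsum : ∑ i, a i ≤ 1)
    (hJsq : ∀ f i, J f i * J f i = J f i)
    (h1 : ∀ i, a i ≠ 0 → m ^ 2 * ∑ f, J f i = M * (m - 1))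
    (h2 : ∀ i j, a i ≠ 0 → a j ≠ 0 → i ≠ j → m ^ 2 * ∑ f, J f i * J f j ≤ M) :
    ∑ f, (m * ∑ i, a i * J f i - ∑ i, a i) ^ 2 ≤ M * (m * W + 2 / m) := by
  set ρ := ∑ i, a i with hρ
  have hρ0 : 0 ≤ ρ := Finset.sum_nonneg fun i _ => ha i
  have e1 : m ^ 2 * ∑ f, (∑ i, a i * J f i) = M * (m - 1) * ρ := by
    rw [Finset.sum_comm, Finset.mul_sum, hρ, Finset.mul_sum]
    refine Finset.sum_congr rfl fun i _ => ?_
    rw [← Finset.mul_sum]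
    by_cases hi : a i = 0
    · simp [hi]
    · rw [← h1 i hi]; ring
  have e2 : m ^ 2 * ∑ f, (∑ i, a i * J f i) ^ 2 ≤ M * ρ ^ 2 + M * m * W * ρ := by
    have e3 : m ^ 2 * ∑ f, (∑ i, a i * J f i) ^ 2
        = ∑ i, ∑ j, a i * a j * (m ^ 2 * ∑ f, J f i * J f j) := by
      simp only [sq (∑ i, a i * J _ i), Finset.sum_mul_sum]
      rw [Finset.sum_comm, Finset.mul_sum]
      refine Finset.sum_congr rfl fun i _ => ?_
      rw [Finset.sum_comm, Finset.mul_sum]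
      refine Finset.sum_congr rfl fun j _ => ?_
      simp only [Finset.mul_sum]
      refine Finset.sum_congr rfl fun f _ => ?_
      ring
    -- Distinct indicators behave like independent ones. On the diagonal J² = J, which costs a
    -- factor m but gains a small weight a i ≤ W.
    have e4 : ∀ i j, a i * a j * (m ^ 2 * ∑ f, J f i * J f j)
        ≤ a i * a j * M + if i = j then a i * W * (M * m) else 0 := by
      intro i j
      by_cases hi : a i = 0
      · simp [hi]
      by_cases hj : a j = 0
      · by_cases hij : i = j
        · exact absurd (hij ▸ hj) hi
        · simp [hj, hij]
      by_cases hij : i = j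
      · subst hij
        simp only [hJsq, if_true]
        rw [h1 i hi]
        have h3 : a i * a i ≤ a i * W := mul_le_mul_of_nonneg_left (haW i) (ha i)
        have h4 : 0 ≤ a i * a i := mul_self_nonneg _
        have h5 : a i * a i * (M * m) ≤ a i * W * (M * m) :=
          mul_le_mul_of_nonneg_right h3 (by positivity)
        have h6 : 0 ≤ a i * a i * M := by positivity
        nlinarith
      · rw [if_neg hij, add_zero]
        exact mul_le_mul_of_nonneg_left (h2 i j hi hj hij) (mul_nonneg (ha i) (ha j))
    rw [e3]
    refine (Finset.sum_le_sum fun i _ => Finset.sum_le_sum fun j _ => e4 i j).trans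
      (le_of_eq ?_)
    simp only [Finset.sum_add_distrib, Finset.sum_ite_eq, Finset.mem_univ, if_true,
      ← Finset.sum_mul, ← Finset.mul_sum, ← hρ]
    ring
  have e5 : ∑ f, (m * ∑ i, a i * J f i - ρ) ^ 2 = m ^ 2 * ∑ f, (∑ i, a i * J f i) ^ 2
      - 2 * ρ / m * (m ^ 2 * ∑ f, (∑ i, a i * J f i)) + M * ρ ^ 2 := by
    have : ∀ f, (m * ∑ i, a i * J f i - ρ) ^ 2 = m ^ 2 * (∑ i, a i * J f i) ^ 2
      - 2 * ρ / m * (m ^ 2 * (∑ i, a i * J f i)) + ρ ^ 2 := by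
      intro f; field_simp; ring
    simp only [this, Finset.sum_add_distrib, Finset.sum_sub_distrib, ← Finset.mul_sum]
    simp [hMc]
  rw [e5, e1]
  have hW : 0 ≤ M * m * W * ρ ∧ M * m * W * ρ ≤ M * m * W := by
    exact ⟨by positivity, mul_le_of_le_one_right (by positivity) hsum⟩
  have e6 : M * ρ ^ 2 + M * m * W * ρ - 2 * ρ / m * (M * (m - 1) * ρ) + M * ρ ^ 2
      = M * m * W * ρ + M * (2 / m) * ρ ^ 2 := by
    field_simp; ring
  have e7 : M * (2 / m) * ρ ^ 2 ≤ M * (2 / m) := by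
    have : 0 ≤ M * (2 / m) := by positivity
    exact mul_le_of_le_one_right this (pow_le_one₀ hρ0 hsum)
  linarith [hW.2]

/-- For x ≥ 1 write x(x - 1) = (x - 1) + (x - 1)² and bound the linear term by AM–GM with parameter
s; moreover x - 1 ≤ x - r. In this form the mass lost by trimming an overfull row or column is
controlled by a variance. -/
theorem excess_le {x r s : ℝ} (hr : r ≤ 1) (hs : 0 < s) :
    x * max 0 (x - 1) ≤ 1 / s + (s / 4 + 1) * (x - r) ^ 2 := by
  rcases le_total x 1 with h | h
  · rw [max_eq_left (by linarith), mul_zero]; positivity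
  · rw [max_eq_right (by linarith)]
    have h1 : (x - 1) ^ 2 ≤ (x - r) ^ 2 := by nlinarith
    have h2 : x - 1 ≤ 1 / s + s / 4 * (x - 1) ^ 2 := by
      have : 0 ≤ 1 / s * (1 - s / 2 * (x - 1)) ^ 2 := by positivity
      have e : 1 / s * (1 - s / 2 * (x - 1)) ^ 2 = 1 / s - (x - 1) + s / 4 * (x - 1) ^ 2 := by
        field_simp; ring
      linarith
    have h3 : (s / 4 + 1) * (x - 1) ^ 2 ≤ (s / 4 + 1) * (x - r) ^ 2 := by gcongr
    nlinarith

open Classical in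
/-- Most assignments of the vertices to `s ^ 2` layers admit a substochastic weighting of the arcs
between consecutive layers whose entries are `s ^ 2` times those of `w`. -/
theorem exists_many_layerings [Fintype V] [DecidableEq V] (w : V → V → ℝ) (s : ℕ) (hs : 1 ≤ s)
    (W t₀ t : ℝ) (hW0 : 0 ≤ W) (hWs : W * (s : ℝ) ^ 4 ≤ 1)
    (hnn : ∀ u v, 0 ≤ w u v) (hdiag : ∀ u, w u u = 0)
    (hrow : ∀ u, ∑ v, w u v ≤ 1) (hcol : ∀ v, ∑ u, w u v ≤ 1)
    (hW : ∀ u v, w u v ≤ W) (htot : (Fintype.card V : ℝ) - t₀ ≤ ∑ u, ∑ v, w u v)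
    (ht0 : 0 < t) (ht : 2 * t₀ + 22 * Fintype.card V / s ≤ t) :
    ((s : ℝ) ^ 2) ^ Fintype.card V ≤ 2 *
      (Finset.univ.filter fun f : V → Fin (s ^ 2) => ∃ w' : V → V → ℝ,
        (∀ u v, 0 ≤ w' u v) ∧ (∀ u v, 0 < w' u v → 0 < w u v ∧ (f u : ℕ) + 1 = f v) ∧
        (∀ u, ∑ v, w' u v ≤ 1) ∧ (∀ v, ∑ u, w' u v ≤ 1) ∧
        (∀ u v, w' u v ≤ (s : ℝ) ^ 2 * W) ∧
        (Fintype.card V : ℝ) - t ≤ ∑ u, ∑ v, w' u v).card := by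
  set n := Fintype.card V with hn
  set m : ℝ := (s : ℝ) ^ 2 with hm
  have hsR : (1 : ℝ) ≤ s := by exact_mod_cast hs
  have hs0 : (0 : ℝ) < s := by linarith
  have hm0 : 0 < m := by positivity
  set M : ℝ := m ^ n with hM
  have hM0 : 0 < M := by positivity
  have hMc : M = Fintype.card (V → Fin (s ^ 2)) := by
    rw [Fintype.card_fun, Fintype.card_fin]; push_cast; rfl
  have hmc : ((s ^ 2 : ℕ) : ℝ) = m := by push_cast; rfl
  have hne : ∀ {u v}, w u v ≠ 0 → u ≠ v := by
    rintro u v h rfl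
    exact h (hdiag u)
  let ξ : (V → Fin (s ^ 2)) → V → ℝ := fun f u => m * ∑ v, w u v * layerStep f u v
  let η : (V → Fin (s ^ 2)) → V → ℝ := fun f v => m * ∑ u, w u v * layerStep f u v
  -- Since W ≤ s⁻⁴ = 1/m², the variance is at most 3/m = 3/s², and s/4 + 1 ≤ 5s/4; the product is
  -- 15/(4s). This is where the hypothesis on `W` is needed.
  have hvar : M * (m * W + 2 / m) * (s / 4 + 1) ≤ M * (4 / s) := by
    have h1 : m * W ≤ 1 / m := by
      rw [le_div_iff₀ hm0, hm]
      nlinarith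
    have h2 : (m * W + 2 / m) * (s / 4 + 1) ≤ 4 / s := by
      calc (m * W + 2 / m) * (s / 4 + 1) ≤ (1 / m + 2 / m) * (s / 4 + s) := by gcongr
        _ = (15 / 4) / s := by rw [hm]; field_simp; ring
        _ ≤ 4 / s := by gcongr; norm_num
    calc _ = M * ((m * W + 2 / m) * (s / 4 + 1)) := by ring
      _ ≤ _ := by gcongr
  have hexc : ∀ (a : V → ℝ) (J : (V → Fin (s ^ 2)) → V → ℝ),
      (∀ i, 0 ≤ a i) → (∀ i, a i ≤ W) → (∑ i, a i ≤ 1) → (∀ f i, J f i * J f i = J f i) →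
      (∀ i, a i ≠ 0 → m ^ 2 * ∑ f, J f i = M * (m - 1)) →
      (∀ i j, a i ≠ 0 → a j ≠ 0 → i ≠ j → m ^ 2 * ∑ f, J f i * J f j ≤ M) →
      ∑ f, (m * ∑ i, a i * J f i) * max 0 ((m * ∑ i, a i * J f i) - 1) ≤ M * (5 / s) := by
    intro a J h1 h2 h3 h4 h5 h6
    have h7 := sum_sq_sub_le a J m W M hm0 hW0 hM0.le hMc h1 h2 h3 h4 h5 h6
    calc _ ≤ ∑ f, (1 / (s : ℝ) + (s / 4 + 1) * (m * ∑ i, a i * J f i - ∑ i, a i) ^ 2) :=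
          Finset.sum_le_sum fun f _ => excess_le h3 hs0
      _ = M * (1 / s) + (s / 4 + 1) * ∑ f, (m * ∑ i, a i * J f i - ∑ i, a i) ^ 2 := by
          rw [Finset.sum_add_distrib, ← Finset.mul_sum, Finset.sum_const, Finset.card_univ,
            nsmul_eq_mul, ← hMc]
      _ ≤ M * (1 / s) + (s / 4 + 1) * (M * (m * W + 2 / m)) := by gcongr
      _ ≤ M * (1 / s) + M * (4 / s) := by linarith
      _ = M * (5 / s) := by ring
  have hξ : ∀ u, ∑ f, ξ f u * max 0 (ξ f u - 1) ≤ M * (5 / s) := by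
    intro u
    refine hexc (fun v => w u v) (fun f v => layerStep f u v) (hnn u) (hW u) (hrow u)
      (fun f v => layerStep_sq f u v) (fun v hv => ?_) (fun v v' hv hv' hvv => ?_)
    · have := sum_layerStep (m := s ^ 2) (hne hv)
      rwa [hmc] at this
    · have := sum_layerStep_mul_out_le (m := s ^ 2) (hne hv) (hne hv') hvv
      rwa [hmc] at this
  have hη : ∀ v, ∑ f, η f v * max 0 (η f v - 1) ≤ M * (5 / s) := by
    intro v
    refine hexc (fun u => w u v) (fun f u => layerStep f u v) (fun u => hnn u v) (fun u => hW u v)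
      (hcol v) (fun f u => layerStep_sq f u v) (fun u hu => ?_) (fun u u' hu hu' huu => ?_)
    · have := sum_layerStep (m := s ^ 2) (hne hu)
      rwa [hmc] at this
    · have := sum_layerStep_mul_in_le (m := s ^ 2) (hne hu) (hne hu') huu
      rwa [hmc] at this
  set S := ∑ u, ∑ v, w u v with hS
  have hSn : S ≤ n := by
    calc S ≤ ∑ u : V, (1 : ℝ) := Finset.sum_le_sum fun u _ => hrow u
      _ = n := by simp [hn]
  have hmean : ∑ f, ∑ u, ξ f u = M * (1 - 1 / m) * S := by
    rw [Finset.sum_comm, hS, Finset.mul_sum]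
    refine Finset.sum_congr rfl fun u _ => ?_
    simp only [ξ]
    rw [← Finset.mul_sum, Finset.sum_comm, Finset.mul_sum, Finset.mul_sum]
    refine Finset.sum_congr rfl fun v _ => ?_
    rw [← Finset.mul_sum]
    by_cases h : w u v = 0
    · simp [h]
    · have := sum_layerStep (m := s ^ 2) (hne h)
      rw [hmc] at this
      have h2 : ∑ f : V → Fin (s ^ 2), layerStep f u v = M * (m - 1) / m ^ 2 := by
        rw [eq_div_iff (by positivity), mul_comm]; exact this
      rw [h2]; field_simp
  -- Dividing each arc by the larger of its scaled row sum ξ and column sum η, when that exceeds 1,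
  -- makes all row and column sums at most 1.
  let w' : (V → Fin (s ^ 2)) → V → V → ℝ := fun f u v =>
    m * w u v * layerStep f u v / max 1 (max (ξ f u) (η f v))
  have hnum : ∀ (f : V → Fin (s ^ 2)) u v, 0 ≤ m * w u v * layerStep f u v := fun f u v =>
    mul_nonneg (mul_nonneg hm0.le (hnn u v)) (layerStep_nonneg f u v)
  have hden : ∀ f u v, 1 ≤ max 1 (max (ξ f u) (η f v)) := fun f u v => le_max_left _ _
  have hden0 : ∀ f u v, 0 < max 1 (max (ξ f u) (η f v)) := fun f u v =>
    lt_of_lt_of_le one_pos (hden f u v)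
  have hw'0 : ∀ f u v, 0 ≤ w' f u v := fun f u v => div_nonneg (hnum f u v) (hden0 f u v).le
  have hξs : ∀ f u, ξ f u = ∑ v, m * w u v * layerStep f u v := by
    intro f u
    simp only [ξ, Finset.mul_sum, mul_assoc]
  have hηs : ∀ f v, η f v = ∑ u, m * w u v * layerStep f u v := by
    intro f v
    simp only [η, Finset.mul_sum, mul_assoc]
  have hw'row : ∀ f u, ∑ v, w' f u v ≤ 1 := by
    intro f u
    have h1 : 0 < max 1 (ξ f u) := lt_of_lt_of_le one_pos (le_max_left _ _)
    calc ∑ v, w' f u v ≤ ∑ v, m * w u v * layerStep f u v / max 1 (ξ f u) := by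
          refine Finset.sum_le_sum fun v _ => ?_
          exact div_le_div_of_nonneg_left (hnum f u v) h1
            (max_le_max le_rfl (le_max_left _ _))
      _ = ξ f u / max 1 (ξ f u) := by rw [← Finset.sum_div, ← hξs]
      _ ≤ 1 := (div_le_one h1).2 (le_max_right _ _)
  have hw'col : ∀ f v, ∑ u, w' f u v ≤ 1 := by
    intro f v
    have h1 : 0 < max 1 (η f v) := lt_of_lt_of_le one_pos (le_max_left _ _)
    calc ∑ u, w' f u v ≤ ∑ u, m * w u v * layerStep f u v / max 1 (η f v) := by
          refine Finset.sum_le_sum fun u _ => ?_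
          exact div_le_div_of_nonneg_left (hnum f u v) h1
            (max_le_max le_rfl (le_max_right _ _))
      _ = η f v / max 1 (η f v) := by rw [← Finset.sum_div, ← hηs]
      _ ≤ 1 := (div_le_one h1).2 (le_max_right _ _)
  have hw'tot : ∀ f, ∑ u, ξ f u - ∑ u, ξ f u * max 0 (ξ f u - 1)
      - ∑ v, η f v * max 0 (η f v - 1) ≤ ∑ u, ∑ v, w' f u v := by
    intro f
    have h1 : ∀ u v, m * w u v * layerStep f u v
        - m * w u v * layerStep f u v * max 0 (ξ f u - 1)
        - m * w u v * layerStep f u v * max 0 (η f v - 1) ≤ w' f u v := by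
      intro u v
      have h2 : 1 - max 0 (ξ f u - 1) - max 0 (η f v - 1)
          ≤ 1 / max 1 (max (ξ f u) (η f v)) := by
        have h3 : max 1 (max (ξ f u) (η f v)) ≤ 1 + max 0 (ξ f u - 1) + max 0 (η f v - 1) := by
          have a1 := le_max_left 0 (ξ f u - 1)
          have a2 := le_max_left 0 (η f v - 1)
          have a3 := le_max_right 0 (ξ f u - 1)
          have a4 := le_max_right 0 (η f v - 1)
          refine max_le (by linarith) (max_le (by linarith) (by linarith))
        have h4 : 1 ≤ max 1 (max (ξ f u) (η f v)) := hden f u v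
        have h5 := hden0 f u v
        rw [le_div_iff₀ h5]
        nlinarith
      calc _ = m * w u v * layerStep f u v * (1 - max 0 (ξ f u - 1) - max 0 (η f v - 1)) := by ring
        _ ≤ m * w u v * layerStep f u v * (1 / max 1 (max (ξ f u) (η f v))) :=
            mul_le_mul_of_nonneg_left h2 (hnum f u v)
        _ = _ := by rw [mul_one_div]
    refine le_trans (le_of_eq ?_)
      (Finset.sum_le_sum fun u _ => Finset.sum_le_sum fun v _ => h1 u v)
    simp only [Finset.sum_sub_distrib]
    congr 1
    · congr 1
      · exact Finset.sum_congr rfl fun u _ => hξs f u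
      · refine Finset.sum_congr rfl fun u _ => ?_
        rw [← Finset.sum_mul, ← hξs]
    · rw [Finset.sum_comm]
      refine Finset.sum_congr rfl fun v _ => ?_
      rw [← Finset.sum_mul, ← hηs]
  set lam : (V → Fin (s ^ 2)) → ℝ := fun f => n - ∑ u, ∑ v, w' f u v with hlam
  have hlam0 : ∀ f, 0 ≤ lam f := by
    intro f
    have : ∑ u, ∑ v, w' f u v ≤ n := by
      calc _ ≤ ∑ u : V, (1 : ℝ) := Finset.sum_le_sum fun u _ => hw'row f u
        _ = n := by simp [hn]
    simp only [hlam]; linarith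
  -- The average missing mass is at most t₀ + n/m from the original deficit and the last layer, plus
  -- 5n/s each for overfull rows and columns. As n/m ≤ n/s, this is at most t₀ + 11n/s ≤ t/2, and
  -- Markov's inequality leaves half of the layerings.
  have hlamsum : ∑ f, lam f ≤ M * (t / 2) := by
    have h1 : ∑ f, ∑ u, ξ f u * max 0 (ξ f u - 1) ≤ n * (M * (5 / s)) := by
      rw [Finset.sum_comm]
      refine (Finset.sum_le_sum fun u _ => hξ u).trans (le_of_eq ?_)
      simp [hn]
    have h2 : ∑ f, ∑ v, η f v * max 0 (η f v - 1) ≤ n * (M * (5 / s)) := by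
      rw [Finset.sum_comm]
      refine (Finset.sum_le_sum fun v _ => hη v).trans (le_of_eq ?_)
      simp [hn]
    have h3 : ∑ f, lam f ≤ ∑ f, ((n : ℝ) - (∑ u, ξ f u - ∑ u, ξ f u * max 0 (ξ f u - 1)
      - ∑ v, η f v * max 0 (η f v - 1))) :=
      Finset.sum_le_sum fun f _ => by simp only [hlam]; linarith [hw'tot f]
    simp only [Finset.sum_sub_distrib, Finset.sum_const, Finset.card_univ, nsmul_eq_mul, ← hMc,
      hmean] at h3
    have h4 : 1 / m ≤ 1 / s := by
      rw [hm]
      refine one_div_le_one_div_of_le hs0 ?_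
      nlinarith
    have h5 : (1 / m) * S ≤ (1 / s) * n :=
      mul_le_mul h4 hSn (Finset.sum_nonneg fun u _ => Finset.sum_nonneg fun v _ => hnn u v)
        (by positivity)
    have h6 : M * (n - (1 - 1 / m) * S + 10 * n / s) ≤ M * (t / 2) := by
      refine mul_le_mul_of_nonneg_left ?_ hM0.le
      have e1 : (1 / (s : ℝ)) * n = n / s := by ring
      have e2 : (22 : ℝ) * n / s = 22 * (n / s) := by ring
      have e3 : (10 : ℝ) * n / s = 10 * (n / s) := by ring
      rw [e1] at h5
      rw [e2] at ht
      rw [e3]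
      linarith
    refine h3.trans (le_trans ?_ h6)
    have e4 : (n : ℝ) * (M * (5 / s)) = M * (5 * n / s) := by ring
    rw [e4] at h1 h2
    have e5 : M * (n - (1 - 1 / m) * S + 10 * n / s)
        = M * n - M * (1 - 1 / m) * S + M * (5 * n / s) + M * (5 * n / s) := by ring
    rw [e5]
    linarith
  set good := Finset.univ.filter fun f : V → Fin (s ^ 2) => lam f ≤ t with hgood
  have hmarkov : M ≤ 2 * good.card := by
    have h1 : ((Finset.univ.filter fun f : V → Fin (s ^ 2) => ¬ lam f ≤ t).card : ℝ) * t
        ≤ M * (t / 2) := by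
      refine le_trans ?_ hlamsum
      rw [← nsmul_eq_mul, ← Finset.sum_const]
      refine (Finset.sum_le_sum fun f hf => ?_).trans
        (Finset.sum_le_sum_of_subset_of_nonneg (Finset.subset_univ _) fun f _ _ => hlam0 f)
      exact (not_le.1 (Finset.mem_filter.1 hf).2).le
    have h2 := Finset.card_filter_add_card_filter_not
      (s := (Finset.univ : Finset (V → Fin (s ^ 2)))) (fun f => lam f ≤ t)
    rw [Finset.card_univ] at h2
    have h3 : (good.card : ℝ)
        + (Finset.univ.filter fun f : V → Fin (s ^ 2) => ¬ lam f ≤ t).card = M := by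
      rw [hMc]; exact_mod_cast h2
    have h4 : ((Finset.univ.filter fun f : V → Fin (s ^ 2) => ¬ lam f ≤ t).card : ℝ)
        ≤ M / 2 := by
      refine le_of_mul_le_mul_right (h1.trans (le_of_eq ?_)) ht0
      ring
    linarith
  refine hmarkov.trans ?_
  have hsub : good ⊆ Finset.univ.filter fun f : V → Fin (s ^ 2) => ∃ w' : V → V → ℝ,
        (∀ u v, 0 ≤ w' u v) ∧ (∀ u v, 0 < w' u v → 0 < w u v ∧ (f u : ℕ) + 1 = f v) ∧
        (∀ u, ∑ v, w' u v ≤ 1) ∧ (∀ v, ∑ u, w' u v ≤ 1) ∧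
        (∀ u v, w' u v ≤ m * W) ∧
        (n : ℝ) - t ≤ ∑ u, ∑ v, w' u v := by
    intro f hf
    refine Finset.mem_filter.2 ⟨Finset.mem_univ _, w' f, hw'0 f, fun u v h => ?_, hw'row f,
      hw'col f, fun u v => ?_, ?_⟩
    · constructor
      · refine lt_of_le_of_ne (hnn u v) fun h0 => ?_
        simp [w', ← h0] at h
      · by_contra h0
        simp [w', layerStep, h0] at h
    · calc w' f u v ≤ m * w u v * layerStep f u v :=
            div_le_self (hnum f u v) (hden f u v)
        _ ≤ m * w u v := by
            refine mul_le_of_le_one_right (mul_nonneg hm0.le (hnn u v)) ?_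
            unfold layerStep; split_ifs <;> norm_num
        _ ≤ m * W := mul_le_mul_of_nonneg_left (hW u v) hm0.le
    · have := (Finset.mem_filter.1 hf).2
      simp only [hlam] at this
      linarith
  have := Finset.card_le_card hsub
  have h2 : (good.card : ℝ) ≤ _ := Nat.cast_le.2 this
  linarith

end Layering

/-! ### Removing non-edges from cyclic enumerations by rotations. -/

section Sequences

variable {V : Type u}

open Classical in
/-- The number of pairs of consecutive entries of a list that are not edges of `G`. -/
noncomputable def badPairs (G : SimpleGraph V) : List V → ℕ
  | [] => 0
  | [_] => 0
  | a :: b :: l => (if G.Adj a b then 0 else 1) + badPairs G (b :: l)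

/-- The number of pairs of cyclically consecutive entries of a list that are not edges of `G`. -/
noncomputable def cyclicBadPairs (G : SimpleGraph V) : List V → ℕ
  | [] => 0
  | a :: l => badPairs G (a :: l ++ [a])

/-- Enumerations of the vertex set with at most `b` cyclically consecutive non-edges. -/
def nearCycles (G : SimpleGraph V) (b : ℕ) : Set (List V) :=
  {l | l.Nodup ∧ (∀ v, v ∈ l) ∧ cyclicBadPairs G l ≤ b}

variable (G : SimpleGraph V)

theorem badPairs_append_cons (l : List V) (a : V) (l' : List V) :
    badPairs G (l ++ a :: l') = badPairs G (l ++ [a]) + badPairs G (a :: l') := by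
  induction l with
  | nil => simp [badPairs]
  | cons x l ih =>
    cases l with
    | nil => simp [badPairs]
    | cons y l =>
      simp only [List.cons_append, badPairs] at ih ⊢
      rw [ih]; ring

theorem badPairs_reverse (l : List V) : badPairs G l.reverse = badPairs G l := by
  induction l with
  | nil => rfl
  | cons a l ih =>
    cases l with
    | nil => rfl
    | cons b l =>
      rw [List.reverse_cons, List.reverse_cons, List.append_assoc, List.singleton_append,
        badPairs_append_cons, ← List.reverse_cons, ih]
      simp only [badPairs, add_zero]
      rw [add_comm]
      by_cases h : G.Adj a b
      · simp [h, h.symm]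
      · have h' : ¬ G.Adj b a := fun h' => h h'.symm
        simp [h, h']

open Classical in
theorem badPairs_append (p : List V) (c d : V) (q : List V) :
    badPairs G ((p ++ [c]) ++ (d :: q)) =
      badPairs G (p ++ [c]) + (if G.Adj c d then 0 else 1) + badPairs G (d :: q) := by
  rw [List.append_assoc, List.singleton_append, badPairs_append_cons]
  simp only [badPairs]; ring

open Classical in
theorem cyclicBadPairs_of_eq {l : List V} {y : V} {a g : List V} {x : V} (h1 : l = y :: a)
    (h2 : l = g ++ [x]) :
    cyclicBadPairs G l = badPairs G l + (if G.Adj x y then 0 else 1) := by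
  have : cyclicBadPairs G l = badPairs G (l ++ [y]) := by subst h1; rfl
  rw [this, h2, badPairs_append]; simp [badPairs]

theorem cyclicBadPairs_append_comm (l l' : List V) :
    cyclicBadPairs G (l ++ l') = cyclicBadPairs G (l' ++ l) := by
  cases l with
  | nil => simp
  | cons a l =>
    cases l' with
    | nil => simp
    | cons b l' =>
      simp only [List.cons_append, cyclicBadPairs, List.append_assoc]
      have h1 := badPairs_append_cons G (a :: l) b (l' ++ [a])
      have h2 := badPairs_append_cons G (b :: l') a (l ++ [b])
      simp only [List.cons_append] at h1 h2
      rw [h1, h2]; ring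

theorem exists_bad_pair {l : List V} (h : badPairs G l ≠ 0) :
    ∃ p x y q, l = p ++ x :: y :: q ∧ ¬ G.Adj x y := by
  induction l with
  | nil => simp [badPairs] at h
  | cons a l ih =>
    cases l with
    | nil => simp [badPairs] at h
    | cons b l =>
      by_cases hab : G.Adj a b
      · simp only [badPairs, hab, if_true, zero_add] at h
        obtain ⟨p, x, y, q, h1, h2⟩ := ih h
        exact ⟨a :: p, x, y, q, by rw [h1]; rfl, h2⟩
      · exact ⟨[], a, b, l, rfl, hab⟩

/-- Cutting the cyclic order open at a non-edge makes it the closing pair, from the last entry `x`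
back to the first entry `y`. -/
theorem exists_rotation_of_bad {l : List V} (h : cyclicBadPairs G l ≠ 0) :
    ∃ l₁ l₂ y a g x, l = l₁ ++ l₂ ∧ l₂ ≠ [] ∧ l₂ ++ l₁ = y :: a ∧ l₂ ++ l₁ = g ++ [x] ∧
      ¬ G.Adj x y := by
  cases l with
  | nil => simp [cyclicBadPairs] at h
  | cons a l =>
    obtain ⟨p, x, y, q, h1, h2⟩ := exists_bad_pair G h
    rcases List.eq_nil_or_concat q with rfl | ⟨q, z, rfl⟩
    · have h3 : (a :: l) ++ [a] = (p ++ [x]) ++ [y] := by simpa using h1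
      obtain ⟨h4, h5⟩ := List.append_inj' h3 rfl
      simp only [List.cons.injEq, and_true] at h5
      exact ⟨[], a :: l, a, l, p, x, rfl, by simp, by simp, by simpa using h4, by rwa [h5]⟩
    · have h3 : (a :: l) ++ [a] = (p ++ [x] ++ (y :: q)) ++ [z] := by simpa using h1
      obtain ⟨h4, -⟩ := List.append_inj' h3 rfl
      exact ⟨p ++ [x], y :: q, y, q ++ (p ++ [x]), y :: q ++ p, x, h4, by simp, by simp, by simp,
        h2⟩

/-- Dirac's pigeonhole: among the n - 1 consecutive pairs, at least n/2 have their second entry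
adjacent to `y` and at least n/2 have their first entry adjacent to `x`, so some pair (c, d) has
both properties. -/
theorem exists_crossing [Fintype V] [DecidableRel G.Adj] {v : List V} (hnd : v.Nodup)
    (hall : ∀ z, z ∈ v) (hdeg : Fintype.card V ≤ 2 * G.minDegree) {y x : V} {a g : List V}
    (hy : v = y :: a) (hx : v = g ++ [x]) :
    ∃ b c d e, v = (b ++ [c]) ++ (d :: e) ∧ G.Adj y d ∧ G.Adj x c := by
  classical
  set n := v.length with hn
  have hcard : Fintype.card V = n := by
    have h1 : v.toFinset = Finset.univ := by ext z; simp [hall z]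
    rw [← Finset.card_univ, ← h1, List.toFinset_card_of_nodup hnd]
  have hy0 : v[0]? = some y := by rw [hy]; rfl
  have hgl : g.length + 1 = n := by rw [hn, hx]; simp
  have hxn : v[n - 1]? = some x := by
    rw [hx, ← hgl]; simp
  obtain ⟨p, hp⟩ : ∃ p : ℕ → Prop, ∀ i, p i ↔ ∃ z, v[i + 1]? = some z ∧ G.Adj y z :=
    ⟨_, fun _ => Iff.rfl⟩
  obtain ⟨q, hq⟩ : ∃ q : ℕ → Prop, ∀ i, q i ↔ ∃ z, v[i]? = some z ∧ G.Adj x z :=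
    ⟨_, fun _ => Iff.rfl⟩
  set P := (Finset.range (n - 1)).filter p with hP
  set Q := (Finset.range (n - 1)).filter q with hQ
  have hPc : G.degree y ≤ P.card := by
    rw [← G.card_neighborFinset_eq_degree]
    refine Finset.card_le_card_of_surjOn (fun i => (v[i + 1]?).getD y) ?_
    intro z hz
    have hz' : G.Adj y z := by simpa using hz
    obtain ⟨k, hk⟩ := List.mem_iff_getElem?.1 (hall z)
    have hkn : k < n := (List.getElem?_eq_some_iff.1 hk).1
    have hk0 : k ≠ 0 := by
      rintro rfl
      rw [hy0] at hk
      exact hz'.ne (Option.some.inj hk)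
    refine ⟨k - 1, ?_, ?_⟩
    · simp only [hP, Finset.coe_filter, Finset.mem_range, Set.mem_ofPred_eq]
      refine ⟨by omega, (hp _).2 ⟨z, ?_, hz'⟩⟩
      rwa [Nat.sub_add_cancel (by omega)]
    · simp only
      rw [Nat.sub_add_cancel (by omega), hk]; rfl
  have hQc : G.degree x ≤ Q.card := by
    rw [← G.card_neighborFinset_eq_degree]
    refine Finset.card_le_card_of_surjOn (fun i => (v[i]?).getD x) ?_
    intro z hz
    have hz' : G.Adj x z := by simpa using hz
    obtain ⟨k, hk⟩ := List.mem_iff_getElem?.1 (hall z)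
    have hkn : k < n := (List.getElem?_eq_some_iff.1 hk).1
    have hk0 : k ≠ n - 1 := by
      rintro rfl
      rw [hxn] at hk
      exact hz'.ne (Option.some.inj hk)
    refine ⟨k, ?_, ?_⟩
    · simp only [hQ, Finset.coe_filter, Finset.mem_range, Set.mem_ofPred_eq]
      exact ⟨by omega, (hq _).2 ⟨z, hk, hz'⟩⟩
    · simp only
      rw [hk]; rfl
  have hne : (P ∩ Q).Nonempty := by
    rw [← Finset.card_pos]
    have h1 := Finset.card_union_add_card_inter P Q
    have h2 : (P ∪ Q).card ≤ n - 1 := by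
      have : P ∪ Q ⊆ Finset.range (n - 1) :=
        Finset.union_subset (Finset.filter_subset _ _) (Finset.filter_subset _ _)
      simpa using Finset.card_le_card this
    have h3 := G.minDegree_le_degree y
    have h4 := G.minDegree_le_degree x
    omega
  obtain ⟨i, hi⟩ := hne
  obtain ⟨hiP, hiQ⟩ := Finset.mem_inter.1 hi
  obtain ⟨d, hd, hyd⟩ := (hp i).1 (Finset.mem_filter.1 hiP).2
  obtain ⟨c, hc, hxc⟩ := (hq i).1 (Finset.mem_filter.1 hiQ).2
  refine ⟨v.take i, c, d, v.drop (i + 2), ?_, hyd, hxc⟩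
  obtain ⟨h1, h2⟩ := List.getElem?_eq_some_iff.1 hd
  obtain ⟨h3, h4⟩ := List.getElem?_eq_some_iff.1 hc
  rw [← h2, ← h4, List.append_assoc, List.singleton_append, ← List.drop_eq_getElem_cons,
    ← List.drop_eq_getElem_cons, List.take_append_drop]

/-- Rotate by `i`, then reverse the initial segment of length `j`. -/
def rotateReverse (i j : ℕ) (l : List V) : List V :=
  ((l.drop i ++ l.take i).take j).reverse ++ (l.drop i ++ l.take i).drop j

theorem rotateReverse_injective {l l' : List V} {i j : ℕ} (hlen : l.length = l'.length)
    (h : rotateReverse i j l = rotateReverse i j l') : l = l' := by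
  unfold rotateReverse at h
  obtain ⟨h1, h2⟩ := List.append_inj h (by simp [hlen])
  have h3 := List.reverse_injective h1
  have h4 : l.drop i ++ l.take i = l'.drop i ++ l'.take i := by
    rw [← List.take_append_drop j (l.drop i ++ l.take i), h3, h2, List.take_append_drop]
  obtain ⟨h5, h6⟩ := List.append_inj h4 (by simp [hlen])
  rw [← List.take_append_drop i l, h5, h6, List.take_append_drop]

theorem rotateReverse_perm (i j : ℕ) (l : List V) : (rotateReverse i j l).Perm l := by
  unfold rotateReverse
  have h1 : (((l.drop i ++ l.take i).take j).reverse ++ (l.drop i ++ l.take i).drop j).Perm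
      (l.drop i ++ l.take i) := by
    conv_rhs => rw [← List.take_append_drop j (l.drop i ++ l.take i)]
    exact (List.reverse_perm _).append_right _
  refine h1.trans ?_
  conv_rhs => rw [← List.take_append_drop i l]
  exact List.perm_append_comm

theorem length_eq_card [Fintype V] {l : List V} (hnd : l.Nodup) (hall : ∀ z, z ∈ l) :
    l.length = Fintype.card V := by
  classical
  have h1 : l.toFinset = Finset.univ := by ext z; simp [hall z]
  rw [← Finset.card_univ, ← h1, List.toFinset_card_of_nodup hnd]

/-- Reversing the segment from `y` to `c` trades the pairs xy and cd for the edges yd and xc. As xy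
is a non-edge, the number of non-edges drops; the n² choices of (i, j) suffice to undo the move. -/
theorem exists_rotateReverse_mem [Fintype V] [Nonempty V] [DecidableRel G.Adj]
    (hdeg : Fintype.card V ≤ 2 * G.minDegree) {b : ℕ} {l : List V} (hl : l ∈ nearCycles G (b + 1)) :
    ∃ i j : Fin (Fintype.card V), rotateReverse i j l ∈ nearCycles G b := by
  obtain ⟨hnd, hall, hbad⟩ := hl
  have hlen := length_eq_card hnd hall
  have hmem : ∀ i j, cyclicBadPairs G (rotateReverse i j l) ≤ b →
      rotateReverse i j l ∈ nearCycles G b := fun i j h =>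
    ⟨(rotateReverse_perm i j l).nodup_iff.2 hnd,
      fun v => (rotateReverse_perm i j l).mem_iff.2 (hall v), h⟩
  have hpos : 0 < Fintype.card V := Fintype.card_pos
  by_cases hb : cyclicBadPairs G l ≤ b
  · refine ⟨⟨0, hpos⟩, ⟨0, hpos⟩, hmem _ _ ?_⟩
    simpa [rotateReverse] using hb
  · obtain ⟨l₁, l₂, y, a, g, x, h1, h0, h2, h3, h4⟩ := exists_rotation_of_bad G
      (l := l) (by omega)
    have hperm : (l₂ ++ l₁).Perm l := by rw [h1]; exact List.perm_append_comm
    obtain ⟨p, c, d, e, h5, h6, h7⟩ := exists_crossing G (hperm.nodup_iff.2 hnd)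
      (fun v => hperm.mem_iff.2 (hall v)) hdeg h2 h3
    have hlen1 : l₁.length < Fintype.card V := by
      rw [← hlen, h1, List.length_append]
      have := List.length_pos_iff.2 h0
      omega
    have hlen2 : p.length + 1 < Fintype.card V := by
      rw [← hlen, ← hperm.length_eq, h5]; simp
    refine ⟨⟨_, hlen1⟩, ⟨_, hlen2⟩, hmem _ _ ?_⟩
    have h8 : rotateReverse l₁.length (p.length + 1) l = (p ++ [c]).reverse ++ (d :: e) := by
      have : l.drop l₁.length ++ l.take l₁.length = l₂ ++ l₁ := by rw [h1]; simp
      unfold rotateReverse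
      rw [this, h5]
      have h9 : p.length + 1 = (p ++ [c]).length := by simp
      rw [h9, List.take_left, List.drop_left]
    simp only
    rw [h8]
    have h10 : cyclicBadPairs G l = badPairs G (p ++ [c]) + (if G.Adj c d then 0 else 1) +
        badPairs G (d :: e) + 1 := by
      rw [h1, cyclicBadPairs_append_comm, cyclicBadPairs_of_eq G h2 h3, h5, badPairs_append]
      simp [h4]
    obtain ⟨p', hp'⟩ : ∃ p', p ++ [c] = y :: p' := by
      cases p with
      | nil => rw [h2] at h5; exact ⟨[], by simp at h5; simp [h5.1]⟩
      | cons z p => rw [h2] at h5; exact ⟨p ++ [c], by simp at h5; simp [h5.1]⟩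
    obtain ⟨e', he'⟩ : ∃ e', d :: e = e' ++ [x] := by
      rw [h3] at h5
      rcases List.eq_nil_or_concat (d :: e) with h | ⟨e', z, h⟩
      · simp at h
      · rw [h, List.concat_eq_append, ← List.append_assoc] at h5
        have := (List.append_inj' h5 rfl).2
        simp only [List.cons.injEq, and_true] at this
        exact ⟨e', by rw [h, this]; simp⟩
    have h11 : cyclicBadPairs G ((p ++ [c]).reverse ++ (d :: e)) =
        badPairs G ((p ++ [c]).reverse ++ (d :: e)) + (if G.Adj x c then 0 else 1) := by
      have ha : (p ++ [c]).reverse ++ (d :: e) = c :: (p.reverse ++ (d :: e)) := by simp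
      have hg : (p ++ [c]).reverse ++ (d :: e) = ((p ++ [c]).reverse ++ e') ++ [x] := by
        rw [he', List.append_assoc]
      rw [cyclicBadPairs_of_eq G ha hg]
      simp [h7]
    have h12 : badPairs G ((p ++ [c]).reverse ++ (d :: e)) =
        badPairs G (p ++ [c]) + badPairs G (d :: e) := by
      have : (p ++ [c]).reverse = p'.reverse ++ [y] := by rw [hp']; simp
      rw [this, badPairs_append, ← this, badPairs_reverse]
      simp [h6]
    rw [h11, h12]
    simp only [h7, if_true]
    omega

instance [Fintype V] (b : ℕ) : Finite (nearCycles G b) := by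
  classical
  refine Set.Finite.subset (s := {l : List V | l.Nodup}) ?_ fun l hl => hl.1
  exact @Set.toFinite _ _ (inferInstanceAs (Finite {l : List V // l.Nodup}))

theorem card_nearCycles_succ_le [Fintype V] [Nonempty V] [DecidableRel G.Adj]
    (hdeg : Fintype.card V ≤ 2 * G.minDegree) (b : ℕ) :
    Nat.card (nearCycles G (b + 1)) ≤ Fintype.card V ^ 2 * Nat.card (nearCycles G b) := by
  classical
  choose i j hij using fun l : nearCycles G (b + 1) => exists_rotateReverse_mem G hdeg l.2
  have : Function.Injective fun l : nearCycles G (b + 1) =>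
      ((i l, j l), (⟨_, hij l⟩ : nearCycles G b)) := by
    intro l l' h
    simp only [Prod.mk.injEq, Subtype.mk.injEq] at h
    obtain ⟨⟨h1, h2⟩, h3⟩ := h
    rw [h1, h2] at h3
    exact Subtype.ext (rotateReverse_injective
      ((length_eq_card l.2.1 l.2.2.1).trans (length_eq_card l'.2.1 l'.2.2.1).symm) h3)
  refine (Nat.card_le_card_of_injective _ this).trans (le_of_eq ?_)
  rw [Nat.card_prod, Nat.card_prod, Nat.card_eq_fintype_card, Fintype.card_fin, sq]

/-- Non-edges of a near-Hamilton cycle can be removed at polynomial cost each. -/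
theorem card_nearCycles_le [Fintype V] [Nonempty V] [DecidableRel G.Adj]
    (hdeg : Fintype.card V ≤ 2 * G.minDegree) (b : ℕ) :
    Nat.card (nearCycles G b) ≤ Fintype.card V ^ (2 * b) * Nat.card (nearCycles G 0) := by
  induction b with
  | zero => simp
  | succ b ih =>
    refine (card_nearCycles_succ_le G hdeg b).trans ?_
    calc _ ≤ Fintype.card V ^ 2 * (Fintype.card V ^ (2 * b) * Nat.card (nearCycles G 0)) := by
          gcongr
      _ = _ := by ring

end Sequences

/-! ### From enumerations without non-edges to Hamilton cycles as subgraphs. -/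

section HamiltonCycles

variable {V : Type u} (G : SimpleGraph V)

theorem isChain_of_badPairs_eq_zero {l : List V} (h : badPairs G l = 0) : l.IsChain G.Adj := by
  induction l with
  | nil => exact List.isChain_nil
  | cons a l ih =>
    cases l with
    | nil => exact List.isChain_singleton a
    | cons b l =>
      simp only [badPairs] at h
      refine List.isChain_cons_cons.2 ⟨?_, ih (by omega)⟩
      by_contra hab
      simp [hab] at h

theorem exists_walk_support_eq {b : V} (l : List V) :
    ∀ {a : V}, (a :: l ++ [b]).IsChain G.Adj → ∃ p : G.Walk a b, p.support = a :: l ++ [b] := by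
  induction l with
  | nil =>
    intro a h
    simp only [List.cons_append, List.nil_append, List.isChain_cons_cons] at h
    exact ⟨.cons h.1 .nil, rfl⟩
  | cons c l ih =>
    intro a h
    simp only [List.cons_append, List.isChain_cons_cons] at h
    obtain ⟨p, hp⟩ := ih h.2
    exact ⟨.cons h.1 p, by simp [hp]⟩

theorem exists_hamiltonianCycle [Fintype V] [DecidableEq V] (hcard : 3 ≤ Fintype.card V) {l : List V}
    (hl : l ∈ nearCycles G 0) :
    ∃ (a : V) (p : G.Walk a a), p.IsHamiltonianCycle ∧ p.support = l ++ [a] ∧ l[0]? = some a := by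
  obtain ⟨hnd, hall, hbad⟩ := hl
  have hlen := length_eq_card hnd hall
  cases l with
  | nil => simp at hlen; omega
  | cons a l =>
    obtain ⟨p, hp⟩ := exists_walk_support_eq G l (isChain_of_badPairs_eq_zero G (Nat.le_zero.1 hbad))
    refine ⟨a, p, ?_, hp, rfl⟩
    have hplen : p.length = Fintype.card V := by
      have := p.length_support
      rw [hp] at this
      simp only [List.length_append, List.length_cons, List.length_nil] at this hlen
      omega
    rw [SimpleGraph.Walk.isHamiltonianCycle_iff_isCycle_and_length_eq]
    refine ⟨?_, hplen⟩
    cases p with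
    | nil => simp at hplen; omega
    | cons h q =>
      rw [SimpleGraph.Walk.cons_isCycle_iff]
      have hq : q.support = l ++ [a] := by
        simpa using hp
      have hqp : q.IsPath := by
        rw [SimpleGraph.Walk.isPath_def, hq]
        exact (List.perm_append_singleton a l).nodup_iff.2 hnd
      refine ⟨hqp, fun he => ?_⟩
      -- A path using the edge between its own ends is that edge, so the closed walk would have
      -- length 2; this is excluded by n ≥ 3.
      have h1 := hqp.length_eq_one_of_mem_edges (by rwa [Sym2.eq_swap])
      simp only [SimpleGraph.Walk.length_cons] at hplen
      omega

/-- A vertex has only two neighbours on a cycle, so the subgraph and two consecutive entries force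
the next one. The first two entries fix basepoint and direction, which gives the factor n² in the
count of enumerations. -/
theorem eq_of_hamiltonianCycle_toSubgraph_eq {a : V} {p p' : G.Walk a a}
    {l l' : List V} (hnd : l.Nodup) (hnd' : l'.Nodup) (hlen : l.length = l'.length)
    (hp : p.support = l ++ [a]) (hp' : p'.support = l' ++ [a]) (h0 : l[0]? = some a)
    (h0' : l'[0]? = some a) (h1 : l[1]? = l'[1]?) (hC : p.toSubgraph = p'.toSubgraph) : l = l' := by
  have hgv : ∀ {q : G.Walk a a} {m : List V}, q.support = m ++ [a] → m[0]? = some a →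
      (∀ i, i < m.length → m[i]? = some (q.getVert i)) ∧ q.getVert m.length = a ∧
        q.length = m.length := by
    intro q m hq hm
    have hql : q.length = m.length := by
      have := q.length_support
      rw [hq] at this
      simpa using this.symm
    refine ⟨fun i hi => ?_, by rw [← hql]; exact q.getVert_length, hql⟩
    have h1 : q.support[i]? = some (q.getVert i) := by
      rw [SimpleGraph.Walk.getVert_eq_support_getElem? q (by omega)]
    rw [hq, List.getElem?_append_left hi] at h1
    exact h1
  obtain ⟨g1, g2, g3⟩ := hgv hp h0
  obtain ⟨g1', g2', g3'⟩ := hgv hp' h0'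
  have inj : ∀ {q : G.Walk a a} {m : List V}, m.Nodup →
      (∀ i, i < m.length → m[i]? = some (q.getVert i)) →
      ∀ i j, i < m.length → j < m.length → q.getVert i = q.getVert j → i = j := by
    intro q m hm hg i j hi hj hij
    have h2 : m[i]? = m[j]? := by rw [hg i hi, hg j hj, hij]
    rw [List.getElem?_eq_getElem hi, List.getElem?_eq_getElem hj] at h2
    exact hm.getElem_inj_iff.1 (Option.some.inj h2)
  have key : ∀ i, i < l.length → p.getVert i = p'.getVert i := by
    intro i
    induction i using Nat.strong_induction_on with
    | _ i ih =>
      intro hi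
      match i, ih, hi with
      | 0, _, _ => simp
      | 1, _, hi =>
        rw [g1 1 hi, g1' 1 (hlen ▸ hi)] at h1
        exact Option.some.inj h1
      | i + 2, ih, hi =>
        have e0 := ih i (by omega) (by omega)
        have e1 := ih (i + 1) (by omega) (by omega)
        have hadj : p'.toSubgraph.Adj (p'.getVert (i + 1)) (p'.getVert (i + 2)) := by
          rw [SimpleGraph.Walk.toSubgraph_adj_iff]
          exact ⟨i + 1, rfl, by omega⟩
        rw [← hC, SimpleGraph.Walk.toSubgraph_adj_iff] at hadj
        obtain ⟨k, hk, hkl⟩ := hadj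
        rw [g3] at hkl
        rw [← e1] at hk
        rcases Sym2.eq_iff.1 hk with ⟨h2, h3⟩ | ⟨h2, h3⟩
        · have := inj hnd g1 _ _ hkl (by omega) h2
          subst this
          exact h3
        -- In the opposite orientation the next vertex would be the preceding one again, or the
        -- cycle would return to its basepoint too early.
        · exfalso
          by_cases hkn : k + 1 = l.length
          · rw [hkn, g2] at h3
            have h4 : p.getVert 0 = p.getVert (i + 1) := by simpa using h3
            have := inj hnd g1 _ _ (by omega) (by omega) h4
            omega
          · have h5 := inj hnd g1 _ _ (by omega) (by omega) h3
            have h6 : k = i := by omega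
            subst h6
            rw [e0] at h2
            have := inj hnd' g1' _ _ (by omega) (by omega) h2
            omega
  refine List.ext_getElem? fun i => ?_
  by_cases hi : i < l.length
  · rw [g1 i hi, g1' i (hlen ▸ hi), key i hi]
  · rw [List.getElem?_eq_none (by omega), List.getElem?_eq_none (by omega)]

theorem card_nearCycles_zero_le [Fintype V] [DecidableEq V] (hcard : 3 ≤ Fintype.card V) :
    Nat.card (nearCycles G 0) ≤ Fintype.card V ^ 2 * numHamiltonCycles G := by
  classical
  choose a p hham hsupp h0 using fun l : nearCycles G 0 => exists_hamiltonianCycle G hcard l.2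
  have hlen : ∀ l : nearCycles G 0, l.1.length = Fintype.card V := fun l =>
    length_eq_card l.2.1 l.2.2.1
  have hinj : Function.Injective fun l : nearCycles G 0 =>
      ((a l, l.1[1]'(by have := hlen l; omega)),
        (⟨(p l).toSubgraph, a l, p l, hham l, rfl⟩ : hamiltonCycles G)) := by
    intro l l' h
    simp only [Prod.mk.injEq] at h
    obtain ⟨⟨h1, h2⟩, h3⟩ := h
    have h1l : 1 < l.1.length := by have := hlen l; omega
    have h1l' : 1 < l'.1.length := by have := hlen l'; omega
    have hs := hsupp l
    have hs0 := h0 l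
    have key : ∀ (b : V) (q : G.Walk b b), a l = b → q.support = l.1 ++ [b] → l.1[0]? = some b →
        q.toSubgraph = (p l').toSubgraph → l = l' := by
      intro b q hb hq hq0 hqs
      have hb' : b = a l' := hb.symm.trans h1
      subst hb'
      refine Subtype.ext (eq_of_hamiltonianCycle_toSubgraph_eq G l.2.1 l'.2.1
        ((hlen l).trans (hlen l').symm) hq (hsupp l') hq0 (h0 l') ?_ hqs)
      rw [List.getElem?_eq_getElem h1l, List.getElem?_eq_getElem h1l', h2]
    exact key (a l) (p l) rfl hs hs0 (congrArg Subtype.val h3)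
  have hfin : Finite (hamiltonCycles G) := Subtype.finite
  refine (Nat.card_le_card_of_injective _ hinj).trans (le_of_eq ?_)
  rw [Nat.card_prod, Nat.card_prod, Nat.card_eq_fintype_card, sq]
  rfl

end HamiltonCycles

/-! ### Greedy partial matchings in dense graphs. -/

section Matchings

variable {V : Type u} [Fintype V] [DecidableEq V]

open Classical in
/-- A relation all of whose out- and in-degrees are at least `|V| / 2 - k` contains a partial
matching that misses at most `2 * k` vertices. -/
theorem exists_partial_matching (R : V → V → Prop) (k : ℕ)
    (hout : ∀ u, Fintype.card V ≤ 2 * (Finset.univ.filter fun v => R u v).card + 2 * k)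
    (hin : ∀ v, Fintype.card V ≤ 2 * (Finset.univ.filter fun u => R u v).card + 2 * k) :
    ∃ φ : V → V ⊕ Fin (2 * k), Function.Injective φ ∧ ∀ u v, φ u = Sum.inl v → R u v := by
  let N : V → Finset (V ⊕ Fin (2 * k)) := fun u =>
    (Finset.univ.filter fun v => R u v).disjSum Finset.univ
  have hall : ∀ s : Finset V, s.card ≤ (s.biUnion N).card := by
    intro s
    rcases s.eq_empty_or_nonempty with rfl | ⟨u, hu⟩
    · simp
    -- Hall's condition: a set with more than n/2 + k points meets every in-neighbourhood, hence
    -- reaches all of V. For a smaller set one member suffices, having at least n/2 - k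
    -- out-neighbours besides the 2k dummies.
    by_cases hs : Fintype.card V < 2 * s.card - 2 * k
    · have h1 : (Finset.univ : Finset V).disjSum (∅ : Finset (Fin (2 * k))) ⊆ s.biUnion N := by
        intro x hx
        rw [Finset.mem_disjSum] at hx
        obtain ⟨v, -, rfl⟩ | ⟨v, hv, -⟩ := hx
        · have h2 := hin v
          have h3 : (s ∩ Finset.univ.filter fun u => R u v).Nonempty := by
            rw [← Finset.card_pos]
            have h4 := Finset.card_union_add_card_inter s (Finset.univ.filter fun u => R u v)
            have h5 := Finset.card_le_univ (s ∪ Finset.univ.filter fun u => R u v)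
            omega
          obtain ⟨u', hu'⟩ := h3
          rw [Finset.mem_inter, Finset.mem_filter] at hu'
          refine Finset.mem_biUnion.2 ⟨u', hu'.1, ?_⟩
          simp [N, hu'.2.2]
        · simp at hv
      have h2 := Finset.card_le_card h1
      rw [Finset.card_disjSum, Finset.card_univ, Finset.card_empty] at h2
      have := Finset.card_le_univ s
      omega
    · have h1 : N u ⊆ s.biUnion N := Finset.subset_biUnion_of_mem N hu
      have h2 := Finset.card_le_card h1
      have h3 := hout u
      have h4 : (N u).card = (Finset.univ.filter fun v => R u v).card + 2 * k := by
        simp [N]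
      omega
  obtain ⟨φ, h1, h2⟩ := (Finset.all_card_le_biUnion_card_iff_exists_injective N).1 hall
  refine ⟨φ, h1, fun u v h => ?_⟩
  have := h2 u
  rw [h] at this
  simpa [N] using this

open Classical in
/-- A graph of minimum degree at least `|V| / 2` contains a digraph with degrees at most `K` and
almost `K * |V|` arcs. -/
theorem exists_almost_regular_digraph (G : SimpleGraph V) [DecidableRel G.Adj]
    (hdeg : Fintype.card V ≤ 2 * G.minDegree) (K : ℕ) :
    ∀ k ≤ K, ∃ D : V → V → Prop, (∀ u v, D u v → G.Adj u v) ∧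
      (∀ u, (Finset.univ.filter fun v => D u v).card ≤ k) ∧
      (∀ v, (Finset.univ.filter fun u => D u v).card ≤ k) ∧
      k * Fintype.card V ≤ ∑ u, (Finset.univ.filter fun v => D u v).card + k * (2 * K) := by
  intro k
  induction k with
  | zero =>
    intro _
    exact ⟨fun _ _ => False, by simp, by simp, by simp, by simp⟩
  | succ k ih =>
    intro hk
    obtain ⟨D, h1, h2, h3, h4⟩ := ih (by omega)
    obtain ⟨R, hR⟩ : ∃ R : V → V → Prop, ∀ u v, R u v ↔ G.Adj u v ∧ ¬ D u v :=
      ⟨_, fun _ _ => Iff.rfl⟩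
    have hout : ∀ u, Fintype.card V ≤ 2 * (Finset.univ.filter fun v => R u v).card + 2 * k := by
      intro u
      have h5 : G.degree u ≤ (Finset.univ.filter fun v => R u v).card
          + (Finset.univ.filter fun v => D u v).card := by
        rw [← G.card_neighborFinset_eq_degree]
        refine (Finset.card_le_card ?_).trans (Finset.card_union_le _ _)
        intro v hv
        have : G.Adj u v := by simpa using hv
        by_cases hD : D u v <;> simp [hR, this, hD]
      have := h2 u
      have := G.minDegree_le_degree u
      omega
    have hin : ∀ v, Fintype.card V ≤ 2 * (Finset.univ.filter fun u => R u v).card + 2 * k := by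
      intro v
      have h5 : G.degree v ≤ (Finset.univ.filter fun u => R u v).card
          + (Finset.univ.filter fun u => D u v).card := by
        rw [← G.card_neighborFinset_eq_degree]
        refine (Finset.card_le_card ?_).trans (Finset.card_union_le _ _)
        intro u hu
        have : G.Adj u v := by
          have : G.Adj v u := by simpa using hu
          exact this.symm
        by_cases hD : D u v <;> simp [hR, this, hD]
      have := h3 v
      have := G.minDegree_le_degree v
      omega
    obtain ⟨φ, hφ, hφR⟩ := exists_partial_matching R k hout hin
    obtain ⟨D', hD'⟩ : ∃ D' : V → V → Prop, ∀ u v, D' u v ↔ D u v ∨ φ u = Sum.inl v :=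
      ⟨_, fun _ _ => Iff.rfl⟩
    have hsplit : ∀ u, (Finset.univ.filter fun v => D' u v).card
        = (Finset.univ.filter fun v => D u v).card
          + (Finset.univ.filter fun v => φ u = Sum.inl v).card := by
      intro u
      rw [← Finset.card_union_of_disjoint]
      · congr 1
        ext v
        simp [hD']
      · rw [Finset.disjoint_filter]
        exact fun v _ hD hv => ((hR u v).1 (hφR u v hv)).2 hD
    refine ⟨D', ?_, ?_, ?_, ?_⟩
    · intro u v huv
      rcases (hD' u v).1 huv with h | h
      · exact h1 u v h
      · exact ((hR u v).1 (hφR u v h)).1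
    · intro u
      have h5 : (Finset.univ.filter fun v => φ u = Sum.inl v).card ≤ 1 := by
        rw [Finset.card_le_one]
        intro a ha b hb
        simp only [Finset.mem_filter, Finset.mem_univ, true_and] at ha hb
        exact Sum.inl_injective (ha.symm.trans hb)
      rw [hsplit]
      have := h2 u
      omega
    · intro v
      have h5 : (Finset.univ.filter fun u => φ u = Sum.inl v).card ≤ 1 := by
        rw [Finset.card_le_one]
        intro a ha b hb
        simp only [Finset.mem_filter, Finset.mem_univ, true_and] at ha hb
        exact hφ (ha.trans hb.symm)
      have h6 : (Finset.univ.filter fun u => D' u v)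
          = (Finset.univ.filter fun u => D u v) ∪ (Finset.univ.filter fun u => φ u = Sum.inl v) := by
        ext u
        simp [hD']
      rw [h6]
      have := Finset.card_union_le (Finset.univ.filter fun u => D u v)
        (Finset.univ.filter fun u => φ u = Sum.inl v)
      have := h3 v
      omega
    · simp only [hsplit, Finset.sum_add_distrib]
      -- A round misses only the vertices matched to one of the 2k dummies, and 2k ≤ 2K.
      have h5 : Fintype.card V ≤
          ∑ u, (Finset.univ.filter fun v => φ u = Sum.inl v).card + 2 * k := by
        have h6 : (Finset.univ.filter fun u : V => ¬ (φ u).isLeft).card ≤ 2 * k := by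
          have : (Finset.univ.filter fun u : V => ¬ (φ u).isLeft).card
              ≤ ((Finset.univ : Finset (Fin (2 * k))).map
                ⟨fun j => (Sum.inr j : V ⊕ Fin (2 * k)), Sum.inr_injective⟩).card := by
            refine Finset.card_le_card_of_injOn φ ?_ hφ.injOn
            intro u hu
            simp only [Finset.coe_filter, Finset.mem_univ, true_and, Set.mem_ofPred_eq] at hu
            rcases h : φ u with v | j
            · simp [h] at hu
            · simp only [Finset.coe_map, Finset.coe_univ, Set.image_univ, Set.mem_range,
                Function.Embedding.coeFn_mk]
              exact ⟨j, rfl⟩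
          simpa using this
        have h7 : (Finset.univ.filter fun u : V => (φ u).isLeft = true).card
            ≤ ∑ u, (Finset.univ.filter fun v => φ u = Sum.inl v).card := by
          rw [Finset.card_filter]
          refine Finset.sum_le_sum fun u _ => ?_
          split_ifs with h
          · obtain ⟨v, hv⟩ := Sum.isLeft_iff.1 h
            exact Finset.card_pos.2 ⟨v, by simp [hv]⟩
          · exact Nat.zero_le _
        have h8 := Finset.card_filter_add_card_filter_not (s := (Finset.univ : Finset V))
          (fun u : V => ((φ u).isLeft = true : Prop))
        rw [Finset.card_univ] at h8
        omega
      nlinarith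

end Matchings

/-! ### Encoding layered permutations by enumerations of the vertices. -/

section Traversal

variable {V : Type u}

theorem eq_of_nodup_of_consecutive {l p p' q q' : List V} {x y y' : V} (hnd : l.Nodup)
    (h : l = p ++ x :: y :: q) (h' : l = p' ++ x :: y' :: q') : y = y' := by
  have hx : l[p.length]? = some x := by rw [h]; simp
  have hx' : l[p'.length]? = some x := by rw [h']; simp
  have hl : p.length < l.length := (List.getElem?_eq_some_iff.1 hx).1
  have hl' : p'.length < l.length := (List.getElem?_eq_some_iff.1 hx').1
  have heq : p.length = p'.length := by
    have h1 : l[p.length]? = l[p'.length]? := hx.trans hx'.symm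
    rw [List.getElem?_eq_getElem hl, List.getElem?_eq_getElem hl'] at h1
    exact hnd.getElem_inj_iff.1 (Option.some.inj h1)
  have hy : l[p.length + 1]? = some y := by
    rw [h, List.getElem?_append_right (by omega)]; simp
  have hy' : l[p'.length + 1]? = some y' := by
    rw [h', List.getElem?_append_right (by omega)]; simp
  rw [heq, hy'] at hy
  exact (Option.some.inj hy).symm

/-- Inserting `u` in front of `v` separates only a pair whose second entry is `v`. -/
theorem consecutive_insert {l₁ l₂ p q : List V} {u v x y : V} (hy : y ≠ v)
    (h : l₁ ++ v :: l₂ = p ++ x :: y :: q) :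
    ∃ p' q', l₁ ++ u :: v :: l₂ = p' ++ x :: y :: q' := by
  rcases List.append_eq_append_iff.1 h with ⟨r, h1, h2⟩ | ⟨r, h1, h2⟩
  · cases r with
    | nil =>
      simp only [List.nil_append, List.cons.injEq] at h2
      exact ⟨l₁ ++ [u], q, by simp [h2.1, h2.2]⟩
    | cons a r =>
      simp only [List.cons_append, List.cons.injEq] at h2
      exact ⟨l₁ ++ u :: v :: r, q, by simp [h2.2]⟩
  · cases r with
    | nil =>
      simp only [List.nil_append, List.cons.injEq] at h2
      exact ⟨l₁ ++ [u], q, by simp [h2.1, h2.2]⟩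
    | cons a r =>
      simp only [List.cons_append, List.cons.injEq] at h2
      obtain ⟨rfl, h3⟩ := h2
      cases r with
      | nil =>
        simp only [List.nil_append, List.cons.injEq] at h3
        exact absurd h3.1 hy
      | cons b r =>
        simp only [List.cons_append, List.cons.injEq] at h3
        obtain ⟨rfl, h3⟩ := h3
        exact ⟨p, r ++ u :: v :: l₂, by simp [h1]⟩

/-- A partial injection without cycles can be completed to an enumeration of all points. -/
theorem exists_traversal [Fintype V] [DecidableEq V] (R : V → V → Prop) (f : V → ℕ)
    (hf : ∀ u v, R u v → f u < f v) (hfun : ∀ u v v', R u v → R u v' → v = v')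
    (hinj : ∀ u u' v, R u v → R u' v → u = u') :
    ∃ l : List V, l.Nodup ∧ (∀ v, v ∈ l) ∧ ∀ u v, R u v → ∃ p q, l = p ++ u :: v :: q := by
  have key : ∀ (k : ℕ) (S : Finset V), S.card = k → (∀ u ∈ S, ∀ v, R u v → v ∈ S) →
      ∃ l : List V, l.Nodup ∧ (∀ v, v ∈ l ↔ v ∈ S) ∧
        ∀ u ∈ S, ∀ v, R u v → ∃ p q, l = p ++ u :: v :: q := by
    intro k
    induction k with
    | zero =>
      intro S hS _
      rw [Finset.card_eq_zero] at hS
      subst hS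
      exact ⟨[], by simp, by simp, by simp⟩
    | succ k ih =>
      intro S hS hcl
      have hne : S.Nonempty := by rw [← Finset.card_pos]; omega
      -- A lowest point has no predecessor in `S`. It can be put back directly before its successor,
      -- which has no other predecessor, without breaking a required pair.
      obtain ⟨u, hu, hmin⟩ := S.exists_min_image f hne
      obtain ⟨l, hl1, hl2, hl3⟩ := ih (S.erase u) (by rw [Finset.card_erase_of_mem hu]; omega) (by
        intro x hx v hxv
        rw [Finset.mem_erase] at hx ⊢
        refine ⟨?_, hcl x hx.2 v hxv⟩
        rintro rfl
        have := hmin x hx.2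
        have := hf x v hxv
        omega)
      have hul : u ∉ l := by rw [hl2]; simp
      by_cases h : ∃ v, R u v
      · obtain ⟨v, huv⟩ := h
        have hvl : v ∈ l := by
          rw [hl2, Finset.mem_erase]
          refine ⟨?_, hcl u hu v huv⟩
          rintro rfl
          exact lt_irrefl _ (hf v v huv)
        obtain ⟨l₁, l₂, rfl⟩ := List.append_of_mem hvl
        have hperm : (l₁ ++ u :: v :: l₂).Perm (u :: (l₁ ++ v :: l₂)) := List.perm_middle
        refine ⟨l₁ ++ u :: v :: l₂, ?_, ?_, ?_⟩
        · rw [hperm.nodup_iff, List.nodup_cons]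
          exact ⟨hul, hl1⟩
        · intro x
          rw [hperm.mem_iff, List.mem_cons, hl2, Finset.mem_erase]
          by_cases hx : x = u
          · simp [hx, hu]
          · simp [hx]
        · intro x hx y hxy
          by_cases hxu : x = u
          · subst hxu
            rw [hfun x y v hxy huv]
            exact ⟨l₁, l₂, rfl⟩
          · obtain ⟨p, q, hpq⟩ := hl3 x (Finset.mem_erase.2 ⟨hxu, hx⟩) y hxy
            refine consecutive_insert ?_ hpq
            rintro rfl
            exact hxu (hinj x u y hxy huv)
      · refine ⟨u :: l, List.nodup_cons.2 ⟨hul, hl1⟩, ?_, ?_⟩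
        · intro x
          rw [List.mem_cons, hl2, Finset.mem_erase]
          by_cases hx : x = u
          · simp [hx, hu]
          · simp [hx]
        · intro x hx y hxy
          have hxu : x ≠ u := by
            rintro rfl
            exact h ⟨y, hxy⟩
          obtain ⟨p, q, hpq⟩ := hl3 x (Finset.mem_erase.2 ⟨hxu, hx⟩) y hxy
          exact ⟨u :: p, q, by rw [hpq]; rfl⟩
  obtain ⟨l, h1, h2, h3⟩ := key _ Finset.univ rfl (by simp)
  exact ⟨l, h1, fun v => (h2 v).2 (Finset.mem_univ v), fun u v => h3 u (Finset.mem_univ u) v⟩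

open Classical in
theorem badPairs_le_countP (G : SimpleGraph V) (P : V → Prop) (l : List V)
    (h : ∀ p q x y, l = p ++ x :: y :: q → ¬ G.Adj x y → P x) :
    badPairs G l ≤ l.countP fun x => decide (P x) := by
  induction l with
  | nil => simp [badPairs]
  | cons a l ih =>
    cases l with
    | nil => simp [badPairs]
    | cons b l =>
      have h1 := ih fun p q x y hpq => h (a :: p) q x y (by rw [hpq]; rfl)
      rw [badPairs, List.countP_cons]
      by_cases hab : G.Adj a b
      · simp only [hab, if_true]; omega
      · have h2 := h [] l a b rfl hab
        simp only [hab, if_false, h2, decide_true, if_true]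
        omega

theorem cyclicBadPairs_le (G : SimpleGraph V) (l : List V) :
    cyclicBadPairs G l ≤ badPairs G l + 1 := by
  classical
  rcases List.eq_nil_or_concat l with rfl | ⟨g, x, h⟩
  · simp [cyclicBadPairs]
  · rw [List.concat_eq_append] at h
    cases l with
    | nil => simp [cyclicBadPairs]
    | cons a l =>
      rw [cyclicBadPairs_of_eq G rfl h]
      split_ifs <;> omega

/-- Permutations of the vertices and `t` dummy points, together with layerings that increase along
the arcs between vertices, are encoded by enumerations with few non-edges and few data. -/
theorem card_layered_perms_le [Fintype V] [DecidableEq V] [Nonempty V] (G : SimpleGraph V)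
    (m t : ℕ) :
    Nat.card {x : (V → Fin m) × Equiv.Perm (V ⊕ Fin t) //
        ∀ u v, x.2 (Sum.inl u) = Sum.inl v → G.Adj u v ∧ (x.1 u : ℕ) + 1 = x.1 v} ≤
      Nat.card (nearCycles G (t + 1)) * ((Fintype.card V + t) ^ t * (Fintype.card V + t) ^ t * m ^ t)
      := by
  classical
  rcases Nat.eq_zero_or_pos m with rfl | hm
  · have : IsEmpty (V → Fin 0) := ⟨fun f => (f (Classical.arbitrary V)).elim0⟩
    have : IsEmpty {x : (V → Fin 0) × Equiv.Perm (V ⊕ Fin t) //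
        ∀ u v, x.2 (Sum.inl u) = Sum.inl v → G.Adj u v ∧ (x.1 u : ℕ) + 1 = x.1 v} :=
      ⟨fun x => IsEmpty.false x.1.1⟩
    simp
  have : Nonempty (Fin m) := ⟨⟨0, hm⟩⟩
  set Ω := {x : (V → Fin m) × Equiv.Perm (V ⊕ Fin t) //
        ∀ u v, x.2 (Sum.inl u) = Sum.inl v → G.Adj u v ∧ (x.1 u : ℕ) + 1 = x.1 v} with hΩ
  have htrav : ∀ x : Ω, ∃ l : List V, l.Nodup ∧ (∀ v, v ∈ l) ∧ ∀ u v,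
      x.1.2 (Sum.inl u) = Sum.inl v → ∃ p q, l = p ++ u :: v :: q := by
    intro x
    refine exists_traversal (fun u v => x.1.2 (Sum.inl u) = Sum.inl v) (fun u => (x.1.1 u : ℕ))
      ?_ ?_ ?_
    · intro u v h
      have := (x.2 u v h).2
      omega
    · intro u v v' h h'
      exact Sum.inl_injective (h.symm.trans h')
    · intro u u' v h h'
      exact Sum.inl_injective (x.1.2.injective (h.trans h'.symm))
  choose l hnd hall hcons using htrav
  -- A non-edge can only follow a vertex that is sent to a dummy, and there are at most `t` of
  -- these; the extra 1 is the closing pair.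
  have hbad : ∀ x : Ω, cyclicBadPairs G (l x) ≤ t + 1 := by
    intro x
    refine (cyclicBadPairs_le G (l x)).trans (Nat.add_le_add_right ?_ 1)
    refine (badPairs_le_countP G (fun u => ∃ k, x.1.2 (Sum.inl u) = Sum.inr k) (l x) ?_).trans ?_
    · intro p q u v hpq hadj
      rcases h : x.1.2 (Sum.inl u) with v' | k
      · obtain ⟨p', q', h'⟩ := hcons x u v' h
        rw [eq_of_nodup_of_consecutive (hnd x) hpq h'] at hadj
        exact absurd (x.2 u v' h).1 hadj
      · exact ⟨k, rfl⟩
    · rw [List.countP_eq_length_filter, ← List.toFinset_card_of_nodup ((hnd x).filter _)]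
      have : ((l x).filter fun u => decide (∃ k, x.1.2 (Sum.inl u) = Sum.inr k)).toFinset.card ≤
          ((Finset.univ : Finset (Fin t)).map
            ⟨fun k => (Sum.inr k : V ⊕ Fin t), Sum.inr_injective⟩).card := by
        refine Finset.card_le_card_of_injOn (fun u => x.1.2 (Sum.inl u)) ?_ ?_
        · intro u hu
          simp only [List.coe_toFinset, List.mem_filter, decide_eq_true_eq, Set.mem_ofPred_eq] at hu
          obtain ⟨-, k, hk⟩ := hu
          simp [hk]
        · intro u _ v _ h
          simpa using h
      simpa using this
  -- The data are the preimages and images of the dummies, and the layers of those images. The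
  -- arbitrary layer given to an image that is itself a dummy is never read.
  let d : Ω → (Fin t → V ⊕ Fin t) × (Fin t → V ⊕ Fin t) × (Fin t → Fin m) := fun x =>
    (fun k => x.1.2.symm (Sum.inr k), fun k => x.1.2 (Sum.inr k),
      fun k => Sum.elim x.1.1 (fun _ => Classical.arbitrary _) (x.1.2 (Sum.inr k)))
  have hinj : Function.Injective fun x : Ω =>
      ((⟨l x, hnd x, hall x, hbad x⟩ : nearCycles G (t + 1)), d x) := by
    intro x x' h
    obtain ⟨h1, h2⟩ := Prod.mk.inj h
    have h1 : l x = l x' := congrArg Subtype.val h1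
    obtain ⟨h3, h4⟩ := Prod.mk.inj h2
    obtain ⟨h4, h5⟩ := Prod.mk.inj h4
    have hπ : x.1.2 = x'.1.2 := by
      ext1 z
      rcases z with u | k
      · rcases e : x.1.2 (Sum.inl u) with v | k
        · rcases e' : x'.1.2 (Sum.inl u) with v' | k'
          · obtain ⟨p, q, hp⟩ := hcons x u v e
            obtain ⟨p', q', hp'⟩ := hcons x' u v' e'
            rw [← h1] at hp'
            rw [eq_of_nodup_of_consecutive (hnd x) hp hp']
          · have h6 : x.1.2.symm (Sum.inr k') = x'.1.2.symm (Sum.inr k') := congrFun h3 k'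
            rw [← e', Equiv.symm_apply_apply, Equiv.symm_apply_eq, e', e] at h6
            exact absurd h6 (by simp)
        · have h6 : x.1.2.symm (Sum.inr k) = x'.1.2.symm (Sum.inr k) := congrFun h3 k
          rw [← e, Equiv.symm_apply_apply] at h6
          rw [h6, Equiv.apply_symm_apply]
          exact e.symm
      · exact congrFun h4 k
    -- Going back along a path lowers the layer by one per step and ends at the image of a dummy,
    -- whose layer is recorded.
    have hf : x.1.1 = x'.1.1 := by
      have : ∀ (j : ℕ) (u : V), (x.1.1 u : ℕ) = j → x.1.1 u = x'.1.1 u := by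
        intro j
        induction j with
        | zero =>
          intro u hu
          rcases e : x.1.2.symm (Sum.inl u) with v | k
          · have e2 : x.1.2 (Sum.inl v) = Sum.inl u := by rw [← e, Equiv.apply_symm_apply]
            have := (x.2 v u e2).2
            omega
          · have e2 : x.1.2 (Sum.inr k) = Sum.inl u := by rw [← e, Equiv.apply_symm_apply]
            have h6 := congrFun h5 k
            simp only [← hπ, e2, Sum.elim_inl] at h6
            exact h6
        | succ j ih =>
          intro u hu
          rcases e : x.1.2.symm (Sum.inl u) with v | k
          · have e2 : x.1.2 (Sum.inl v) = Sum.inl u := by rw [← e, Equiv.apply_symm_apply]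
            have h6 := (x.2 v u e2).2
            have h7 := (x'.2 v u (hπ ▸ e2)).2
            have h8 := ih v (by omega)
            refine Fin.ext ?_
            rw [← h6, ← h7, h8]
          · have e2 : x.1.2 (Sum.inr k) = Sum.inl u := by rw [← e, Equiv.apply_symm_apply]
            have h6 := congrFun h5 k
            simp only [← hπ, e2, Sum.elim_inl] at h6
            exact h6
      funext u
      exact this _ u rfl
    exact Subtype.ext (Prod.ext hf hπ)
  refine (Nat.card_le_card_of_injective _ hinj).trans (le_of_eq ?_)
  rw [Nat.card_prod]
  congr 1
  simp only [Nat.card_eq_fintype_card, Fintype.card_prod, Fintype.card_fun, Fintype.card_sum,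
    Fintype.card_fin]
  ring

end Traversal

/-! ### Comparing the two counts. -/

section Counting

theorem reg_le_card {V : Type u} [Fintype V] [Nonempty V] (G : SimpleGraph V) : reg G ≤ Fintype.card V := by
  classical
  obtain ⟨H, -, hH⟩ := (isGreatest_reg G).1
  obtain ⟨v⟩ := ‹Nonempty V›
  rw [← hH v]
  exact (H.degree_lt_card_verts v).le

variable {V : Type u} [Fintype V] [DecidableEq V]

theorem card_layered_perms_lower (G : SimpleGraph V) (w : V → V → ℝ) (s t : ℕ)
    (hs : 1 ≤ s) (W t₀ : ℝ) (hW0 : 0 < W) (hWs : W * (s : ℝ) ^ 4 ≤ 1)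
    (hnn : ∀ u v, 0 ≤ w u v) (hadj : ∀ u v, 0 < w u v → G.Adj u v)
    (hrow : ∀ u, ∑ v, w u v ≤ 1) (hcol : ∀ v, ∑ u, w u v ≤ 1)
    (hW : ∀ u v, w u v ≤ W) (htot : (Fintype.card V : ℝ) - t₀ ≤ ∑ u, ∑ v, w u v)
    (ht0 : 0 < t) (ht : 2 * t₀ + 22 * Fintype.card V / s ≤ t) :
    ((s : ℝ) ^ 2) ^ Fintype.card V * Real.exp (-(Fintype.card V + t : ℕ)) ≤ 2 *
      ((Nat.card {x : (V → Fin (s ^ 2)) × Equiv.Perm (V ⊕ Fin t) //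
        ∀ u v, x.2 (Sum.inl u) = Sum.inl v → G.Adj u v ∧ (x.1 u : ℕ) + 1 = x.1 v} : ℝ) *
        ((s : ℝ) ^ 2 * W) ^ (Fintype.card V - t)) := by
  classical
  have hsR : (1 : ℝ) ≤ s := by exact_mod_cast hs
  have hdiag : ∀ u, w u u = 0 := by
    intro u
    by_contra h
    exact G.irrefl (hadj u u (lt_of_le_of_ne (hnn u u) (Ne.symm h)))
  have hlay := exists_many_layerings w s hs W t₀ t hW0.le hWs hnn hdiag hrow hcol hW htot
    (by exact_mod_cast ht0) ht
  set good := Finset.univ.filter fun f : V → Fin (s ^ 2) => ∃ w' : V → V → ℝ,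
        (∀ u v, 0 ≤ w' u v) ∧ (∀ u v, 0 < w' u v → 0 < w u v ∧ (f u : ℕ) + 1 = f v) ∧
        (∀ u, ∑ v, w' u v ≤ 1) ∧ (∀ v, ∑ u, w' u v ≤ 1) ∧
        (∀ u v, w' u v ≤ (s : ℝ) ^ 2 * W) ∧
        (Fintype.card V : ℝ) - t ≤ ∑ u, ∑ v, w' u v with hgood
  set E := Real.exp (-(Fintype.card V + t : ℕ)) with hE
  have hE0 : 0 < E := Real.exp_pos _
  set W' := (s : ℝ) ^ 2 * W with hW'
  have hW'0 : 0 < W' := by positivity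
  have hW'1 : W' ≤ 1 := by
    refine le_trans ?_ hWs
    rw [hW', mul_comm]
    exact mul_le_mul_of_nonneg_left (pow_le_pow_right₀ hsR (by norm_num)) hW0.le
  set c : (V → Fin (s ^ 2)) → ℕ := fun f => Nat.card {π : Equiv.Perm (V ⊕ Fin t) //
    ∀ u v, π (Sum.inl u) = Sum.inl v → G.Adj u v ∧ (f u : ℕ) + 1 = f v} with hc
  have hcf : ∀ f ∈ good, E ≤ c f * W' ^ (Fintype.card V - t) := by
    intro f hf
    obtain ⟨w', h0, hsupp, h1, h2, h3, h4⟩ := (Finset.mem_filter.1 hf).2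
    refine (exp_neg_le_card_perm_mul w' t ht0 W' hW'1 h0 h1 h2 h3 hW'0 h4).trans ?_
    refine mul_le_mul_of_nonneg_right ?_ (by positivity)
    rw [Nat.cast_le]
    refine Nat.card_le_card_of_injective
      (fun π => ⟨π.1, fun u v h => ?_⟩) fun π π' h => Subtype.ext (Subtype.mk.inj h)
    have h5 := hsupp u v (π.2 u v h)
    exact ⟨hadj u v h5.1, h5.2⟩
  have hcsum : (Nat.card {x : (V → Fin (s ^ 2)) × Equiv.Perm (V ⊕ Fin t) //
        ∀ u v, x.2 (Sum.inl u) = Sum.inl v → G.Adj u v ∧ (x.1 u : ℕ) + 1 = x.1 v})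
      = ∑ f, c f := by
    rw [← Nat.card_sigma]
    exact Nat.card_congr (Equiv.subtypeProdEquivSigmaSubtype
      fun (f : V → Fin (s ^ 2)) (π : Equiv.Perm (V ⊕ Fin t)) =>
        ∀ u v, π (Sum.inl u) = Sum.inl v → G.Adj u v ∧ (f u : ℕ) + 1 = f v)
  rw [hcsum]
  have hsum : (good.card : ℝ) * E ≤ (∑ f, c f : ℕ) * W' ^ (Fintype.card V - t) := by
    rw [← nsmul_eq_mul, ← Finset.sum_const]
    push_cast
    rw [Finset.sum_mul]
    refine (Finset.sum_le_sum hcf).trans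
      (Finset.sum_le_sum_of_subset_of_nonneg (Finset.subset_univ _) fun f _ _ => by positivity)
  calc ((s : ℝ) ^ 2) ^ Fintype.card V * E ≤ 2 * good.card * E := by gcongr
    _ = 2 * (good.card * E) := by ring
    _ ≤ _ := by gcongr

/-- An r-factor with r = reg G ≥ K gives weights 1/r and no deficit. If reg G is smaller, the
digraph made of K greedy matchings gives weights 1/K with deficit at most 2K, which is even better
for the final bound. -/
theorem exists_weighting (G : SimpleGraph V) [DecidableRel G.Adj] [Nonempty V]
    (hdeg : Fintype.card V ≤ 2 * G.minDegree) (K : ℕ) (hK : 0 < K) :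
    ∃ w : V → V → ℝ, (∀ u v, 0 ≤ w u v) ∧ (∀ u v, 0 < w u v → G.Adj u v) ∧
      (∀ u, ∑ v, w u v ≤ 1) ∧ (∀ v, ∑ u, w u v ≤ 1) ∧
      (∀ u v, w u v ≤ ((max (reg G) K : ℕ) : ℝ)⁻¹) ∧
      (Fintype.card V : ℝ) - 2 * K ≤ ∑ u, ∑ v, w u v := by
  classical
  have key : ∀ (q : ℕ) (D : V → V → Prop), 0 < q → (∀ u v, D u v → G.Adj u v) →
      (∀ u, (Finset.univ.filter fun v => D u v).card ≤ q) →
      (∀ v, (Finset.univ.filter fun u => D u v).card ≤ q) →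
      q * Fintype.card V ≤ ∑ u, (Finset.univ.filter fun v => D u v).card + q * (2 * K) →
      ∃ w : V → V → ℝ, (∀ u v, 0 ≤ w u v) ∧ (∀ u v, 0 < w u v → G.Adj u v) ∧
      (∀ u, ∑ v, w u v ≤ 1) ∧ (∀ v, ∑ u, w u v ≤ 1) ∧
      (∀ u v, w u v ≤ (q : ℝ)⁻¹) ∧
      (Fintype.card V : ℝ) - 2 * K ≤ ∑ u, ∑ v, w u v := by
    intro q D hq h1 h2 h3 h4
    have hq' : (0 : ℝ) < q := by exact_mod_cast hq
    have e1 : ∀ u, ∑ v, (if D u v then (q : ℝ)⁻¹ else 0)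
        = (Finset.univ.filter fun v => D u v).card * (q : ℝ)⁻¹ := by
      intro u
      rw [← Finset.sum_filter, Finset.sum_const, nsmul_eq_mul]
    refine ⟨fun u v => if D u v then (q : ℝ)⁻¹ else 0, fun u v => ?_, fun u v h => ?_,
      fun u => ?_, fun v => ?_, fun u v => ?_, ?_⟩
    · dsimp only; split_ifs <;> positivity
    · by_contra hn
      have : ¬ D u v := fun hD => hn (h1 u v hD)
      simp [this] at h
    · rw [e1, ← div_eq_mul_inv, div_le_one hq']
      exact_mod_cast h2 u
    · rw [← Finset.sum_filter, Finset.sum_const, nsmul_eq_mul, ← div_eq_mul_inv, div_le_one hq']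
      exact_mod_cast h3 v
    · dsimp only
      split_ifs
      · exact le_rfl
      · positivity
    · simp only [e1]
      rw [← Finset.sum_mul, ← div_eq_mul_inv, le_div_iff₀ hq']
      have h5 : (q : ℝ) * Fintype.card V
          ≤ ∑ u, ((Finset.univ.filter fun v => D u v).card : ℝ) + q * (2 * K) := by
        exact_mod_cast h4
      linarith
  rcases le_total K (reg G) with h | h
  · rw [max_eq_left h]
    obtain ⟨H, hHG, hH⟩ := (isGreatest_reg G).1
    have hd : ∀ u, (Finset.univ.filter fun v => H.Adj u v).card = reg G := by
      intro u
      rw [← hH u, ← SimpleGraph.card_neighborFinset_eq_degree]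
      congr 1
      ext v
      simp
    refine key (reg G) H.Adj (by omega) (fun u v h => hHG h) (fun u => (hd u).le) (fun v => ?_) ?_
    · simp only [H.adj_comm _ v]
      exact (hd v).le
    · simp only [hd, Finset.sum_const, Finset.card_univ, smul_eq_mul]
      rw [mul_comm]
      exact Nat.le_add_right _ _
  · rw [max_eq_right h]
    obtain ⟨D, h1, h2, h3, h4⟩ := exists_almost_regular_digraph G hdeg K K le_rfl
    refine key K D hK h1 (fun u => ?_) (fun v => ?_) ?_
    · convert h2 u
    · convert h3 v
    · convert h4

/-- The quantitative form of the lower bound on the number of Hamilton cycles. -/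
theorem reg_div_exp_pow_le (G : SimpleGraph V) [DecidableRel G.Adj]
    (hcard : 3 ≤ Fintype.card V) (hdeg : Fintype.card V ≤ 2 * G.minDegree) (s t : ℕ) (hs : 1 ≤ s)
    (hsn : s ^ 4 ≤ Fintype.card V) (ht0 : 0 < t) (htn : t ≤ Fintype.card V)
    (ht : 4 * (s : ℝ) ^ 4 + 22 * Fintype.card V / s ≤ t) :
    ((reg G : ℝ) / Real.exp 1) ^ Fintype.card V ≤
      (12 * Fintype.card V : ℝ) ^ (5 * t + 5) * numHamiltonCycles G := by
  have hne : Nonempty V := Fintype.card_pos_iff.1 (by omega)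
  set n := Fintype.card V with hn
  have hsR : (1 : ℝ) ≤ s := by exact_mod_cast hs
  obtain ⟨w, h0, hadj, hrow, hcol, hW, htot⟩ := exists_weighting G hdeg (s ^ 4) (by positivity)
  set q := max (reg G) (s ^ 4) with hq
  have hqn : q ≤ n := max_le (reg_le_card G) hsn
  have hq1 : 1 ≤ q := le_max_of_le_right (Nat.one_le_pow _ _ hs)
  have hqR : (1 : ℝ) ≤ q := by exact_mod_cast hq1
  have hq0 : (0 : ℝ) < q := by linarith
  have hqs : (s : ℝ) ^ 4 ≤ q := by
    have : s ^ 4 ≤ q := le_max_right _ _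
    exact_mod_cast this
  have hlow := card_layered_perms_lower G w s t hs (q : ℝ)⁻¹ (2 * (s ^ 4 : ℕ)) (by positivity)
    (by rw [inv_mul_le_iff₀ hq0]; linarith) h0 hadj hrow hcol hW htot ht0
    (by push_cast; linarith)
  have hup1 := card_layered_perms_le G (s ^ 2) t
  have hup2 := card_nearCycles_le G hdeg (t + 1)
  have hup3 := card_nearCycles_zero_le G hcard
  rw [← hn] at hlow hup1 hup2 hup3
  set h := numHamiltonCycles G with hh
  have hnR : (3 : ℝ) ≤ n := by exact_mod_cast hcard
  set X := Nat.card {x : (V → Fin (s ^ 2)) × Equiv.Perm (V ⊕ Fin t) //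
        ∀ u v, x.2 (Sum.inl u) = Sum.inl v → G.Adj u v ∧ (x.1 u : ℕ) + 1 = x.1 v} with hX
  have hXh : X ≤ n ^ (2 * t + 4) * (2 * n) ^ (2 * t) * h * (s ^ 2) ^ t := by
    calc X ≤ (n ^ (2 * (t + 1)) * (n ^ 2 * h)) * ((n + t) ^ t * (n + t) ^ t * (s ^ 2) ^ t) := by
          refine hup1.trans (Nat.mul_le_mul_right _ (hup2.trans (Nat.mul_le_mul_left _ hup3)))
      _ ≤ (n ^ (2 * (t + 1)) * (n ^ 2 * h)) * ((2 * n) ^ t * (2 * n) ^ t * (s ^ 2) ^ t) := by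
          gcongr <;> omega
      _ = _ := by ring
  have hXhR : (X : ℝ) ≤ (n : ℝ) ^ (2 * t + 4) * (2 * n) ^ (2 * t) * h * ((s : ℝ) ^ 2) ^ t := by
    exact_mod_cast hXh
  set m : ℝ := (s : ℝ) ^ 2 with hm
  have hm0 : 0 < m := by positivity
  have hexp : Real.exp (-(n + t : ℕ)) = (Real.exp 1 ^ n)⁻¹ * (Real.exp 1 ^ t)⁻¹ := by
    rw [Real.exp_neg, ← mul_inv, ← pow_add, ← Real.exp_nat_mul, mul_one]
  have hsplit : m ^ n = m ^ t * m ^ (n - t) := by rw [← pow_add]; congr 1; omega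
  have hqsplit : (q : ℝ) ^ n = q ^ t * q ^ (n - t) := by rw [← pow_add]; congr 1; omega
  -- The number mⁿ of layerings cancels against the factor m^(n - t) in the scaled weights and the
  -- mᵗ recorded layers.
  have hmain : (Real.exp 1 ^ n)⁻¹ * (Real.exp 1 ^ t)⁻¹
      ≤ 2 * ((n : ℝ) ^ (2 * t + 4) * (2 * n) ^ (2 * t) * h) * ((q : ℝ) ^ (n - t))⁻¹ := by
    have h1 : m ^ n * ((Real.exp 1 ^ n)⁻¹ * (Real.exp 1 ^ t)⁻¹) ≤ m ^ n *
        (2 * ((n : ℝ) ^ (2 * t + 4) * (2 * n) ^ (2 * t) * h) * ((q : ℝ) ^ (n - t))⁻¹) := by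
      rw [← hexp]
      refine hlow.trans ?_
      calc 2 * ((X : ℝ) * (m * (q : ℝ)⁻¹) ^ (n - t))
          ≤ 2 * (((n : ℝ) ^ (2 * t + 4) * (2 * n) ^ (2 * t) * h * m ^ t)
            * (m * (q : ℝ)⁻¹) ^ (n - t)) := by gcongr
        _ = _ := by rw [hsplit, mul_pow m, inv_pow]; ring
    exact le_of_mul_le_mul_left h1 (by positivity)
  have he3 : Real.exp 1 ≤ 3 := Real.exp_one_lt_three.le
  have hfin : ((q : ℝ) / Real.exp 1) ^ n
      ≤ 2 * ((n : ℝ) ^ (2 * t + 4) * (2 * n) ^ (2 * t) * h) * q ^ t * Real.exp 1 ^ t := by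
    have h2 : (q : ℝ) ^ n * Real.exp 1 ^ t * ((Real.exp 1 ^ n)⁻¹ * (Real.exp 1 ^ t)⁻¹)
        ≤ (q : ℝ) ^ n * Real.exp 1 ^ t *
          (2 * ((n : ℝ) ^ (2 * t + 4) * (2 * n) ^ (2 * t) * h) * ((q : ℝ) ^ (n - t))⁻¹) :=
      mul_le_mul_of_nonneg_left hmain (by positivity)
    have h3 : (q : ℝ) ^ n * Real.exp 1 ^ t * ((Real.exp 1 ^ n)⁻¹ * (Real.exp 1 ^ t)⁻¹)
        = ((q : ℝ) / Real.exp 1) ^ n := by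
      rw [div_pow]
      have := Real.exp_pos 1
      field_simp
    rw [h3] at h2
    refine h2.trans (le_of_eq ?_)
    rw [hqsplit]
    field_simp
  have hqnR : (q : ℝ) ≤ n := by exact_mod_cast hqn
  calc ((reg G : ℝ) / Real.exp 1) ^ n ≤ ((q : ℝ) / Real.exp 1) ^ n := by
        have : (reg G : ℝ) ≤ q := by exact_mod_cast le_max_left _ _
        gcongr
    _ ≤ _ := hfin
    _ ≤ 2 * ((n : ℝ) ^ (2 * t + 4) * (2 * n) ^ (2 * t) * h) * n ^ t * 3 ^ t := by gcongr
    -- The powers of n come from rotations and basepoints (2t + 4), the dummy data (2t) and the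
    -- surplus qᵗ (t); 12 = 2² · 3 stems from n + t ≤ 2n and e ≤ 3.
    _ = (2 * 12 ^ t * (n : ℝ) ^ (5 * t + 4)) * h := by
        have : (12 : ℝ) ^ t = 2 ^ (2 * t) * 3 ^ t := by
          rw [pow_mul, ← mul_pow]; norm_num
        rw [this, mul_pow]; ring
    _ ≤ (12 ^ (5 * t + 5) * (n : ℝ) ^ (5 * t + 5)) * h := by
        have h4 : (2 : ℝ) * 12 ^ t ≤ 12 ^ (5 * t + 5) := by
          calc (2 : ℝ) * 12 ^ t ≤ 12 * 12 ^ t := by gcongr; norm_num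
            _ = 12 ^ (t + 1) := by ring
            _ ≤ _ := pow_le_pow_right₀ (by norm_num) (by omega)
        have h5 : (n : ℝ) ^ (5 * t + 4) ≤ (n : ℝ) ^ (5 * t + 5) :=
          pow_le_pow_right₀ (by linarith) (by omega)
        gcongr
    _ = _ := by rw [mul_pow]

end Counting

/-! ### Choice of parameters and the error term. -/

section Asymptotics

/-- The square root of the number of layers used for graphs on `n` vertices. -/
noncomputable def layerRoot (n : ℕ) : ℕ := ⌊(n : ℝ) ^ (1 / 5 : ℝ)⌋₊

/-- The number of dummy points, hence of paths in a path cover, used for graphs on `n` vertices. -/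
noncomputable def defect (n : ℕ) : ℕ := ⌈4 * (layerRoot n : ℝ) ^ 4 + 22 * n / layerRoot n⌉₊

/-- The logarithmic error per vertex. -/
noncomputable def logError (n : ℕ) : ℝ := (5 * defect n + 5 : ℕ) * Real.log (12 * n) / n

theorem one_le_layerRoot {n : ℕ} (hn : 1 ≤ n) : 1 ≤ layerRoot n := by
  unfold layerRoot
  rw [Nat.one_le_floor_iff]
  exact Real.one_le_rpow (by exact_mod_cast hn) (by norm_num)

theorem layerRoot_pow_le (n : ℕ) : (layerRoot n : ℝ) ^ 4 ≤ (n : ℝ) ^ (4 / 5 : ℝ) := by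
  have h1 : (layerRoot n : ℝ) ≤ (n : ℝ) ^ (1 / 5 : ℝ) := Nat.floor_le (by positivity)
  calc (layerRoot n : ℝ) ^ 4 ≤ ((n : ℝ) ^ (1 / 5 : ℝ)) ^ 4 := by gcongr
    _ = (n : ℝ) ^ (4 / 5 : ℝ) := by
      rw [← Real.rpow_natCast, ← Real.rpow_mul (by positivity)]; norm_num

theorem layerRoot_pow_le_self {n : ℕ} (hn : 1 ≤ n) : layerRoot n ^ 4 ≤ n := by
  have h1 := layerRoot_pow_le n
  have hn' : (1 : ℝ) ≤ n := by exact_mod_cast hn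
  have h2 : (n : ℝ) ^ (4 / 5 : ℝ) ≤ n := by
    conv_rhs => rw [← Real.rpow_one (n : ℝ)]
    exact Real.rpow_le_rpow_of_exponent_le hn' (by norm_num)
  exact_mod_cast h1.trans h2

/-- Taking s near n^{1/5} balances s⁴ against n/s. Rounding s down at most doubles n/s, so the
constant is 4 + 44, plus 1 for the ceiling. -/
theorem defect_le {n : ℕ} (hn : 1 ≤ n) : (defect n : ℝ) ≤ 49 * (n : ℝ) ^ (4 / 5 : ℝ) := by
  have hn' : (1 : ℝ) ≤ n := by exact_mod_cast hn
  have hn0 : (0 : ℝ) < n := by linarith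
  have hs : (1 : ℝ) ≤ layerRoot n := by exact_mod_cast one_le_layerRoot hn
  have h1 := layerRoot_pow_le n
  have hx : (n : ℝ) ^ (1 / 5 : ℝ) ≤ 2 * layerRoot n := by
    have : (n : ℝ) ^ (1 / 5 : ℝ) < layerRoot n + 1 := Nat.lt_floor_add_one _
    linarith
  have h2 : (n : ℝ) / layerRoot n ≤ 2 * (n : ℝ) ^ (4 / 5 : ℝ) := by
    rw [div_le_iff₀ (by linarith)]
    calc (n : ℝ) = (n : ℝ) ^ (4 / 5 : ℝ) * (n : ℝ) ^ (1 / 5 : ℝ) := by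
          rw [← Real.rpow_add hn0]; norm_num
      _ ≤ (n : ℝ) ^ (4 / 5 : ℝ) * (2 * layerRoot n) := by gcongr
      _ = _ := by ring
  have h3 : (1 : ℝ) ≤ (n : ℝ) ^ (4 / 5 : ℝ) := Real.one_le_rpow hn' (by norm_num)
  have h4 : (defect n : ℝ) < 4 * (layerRoot n : ℝ) ^ 4 + 22 * n / layerRoot n + 1 :=
    Nat.ceil_lt_add_one (by positivity)
  have h5 : (22 : ℝ) * n / layerRoot n = 22 * (n / layerRoot n) := by ring
  rw [h5] at h4
  linarith

theorem tendsto_logError : Tendsto logError atTop (𝓝 0) := by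
  have h1 : Tendsto (fun n : ℕ => Real.log n / (n : ℝ) ^ (1 / 5 : ℝ)) atTop (𝓝 0) :=
    ((isLittleO_log_rpow_atTop (show (0 : ℝ) < 1 / 5 by norm_num)).tendsto_div_nhds_zero).comp
      tendsto_natCast_atTop_atTop
  have h2 : Tendsto (fun n : ℕ => Real.log 12 / (n : ℝ) ^ (1 / 5 : ℝ)) atTop (𝓝 0) :=
    ((tendsto_rpow_atTop (show (0 : ℝ) < 1 / 5 by norm_num)).comp
      tendsto_natCast_atTop_atTop).const_div_atTop _
  have h3 : Tendsto (fun n : ℕ => 250 * (Real.log 12 / (n : ℝ) ^ (1 / 5 : ℝ)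
      + Real.log n / (n : ℝ) ^ (1 / 5 : ℝ))) atTop (𝓝 0) := by
    simpa using (h2.add h1).const_mul 250
  refine squeeze_zero' ?_ ?_ h3
  · filter_upwards [eventually_ge_atTop 1] with n hn
    have hn' : (1 : ℝ) ≤ n := by exact_mod_cast hn
    have : 0 ≤ Real.log (12 * n) := Real.log_nonneg (by linarith)
    unfold logError
    positivity
  · filter_upwards [eventually_ge_atTop 1] with n hn
    have hn' : (1 : ℝ) ≤ n := by exact_mod_cast hn
    have hn0 : (0 : ℝ) < n := by linarith
    have hlog : 0 ≤ Real.log (12 * n) := Real.log_nonneg (by linarith)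
    have h4 : ((5 * defect n + 5 : ℕ) : ℝ) ≤ 250 * (n : ℝ) ^ (4 / 5 : ℝ) := by
      have := defect_le hn
      have h5 : (1 : ℝ) ≤ (n : ℝ) ^ (4 / 5 : ℝ) := Real.one_le_rpow hn' (by norm_num)
      push_cast
      linarith
    have e1 : (n : ℝ) = (n : ℝ) ^ (4 / 5 : ℝ) * (n : ℝ) ^ (1 / 5 : ℝ) := by
      rw [← Real.rpow_add hn0]; norm_num
    have hx4 : (0 : ℝ) < (n : ℝ) ^ (4 / 5 : ℝ) := by positivity
    have hx1 : (0 : ℝ) < (n : ℝ) ^ (1 / 5 : ℝ) := by positivity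
    calc logError n ≤ 250 * (n : ℝ) ^ (4 / 5 : ℝ) * Real.log (12 * n) / n := by
          unfold logError; gcongr
      _ = 250 * (Real.log (12 * n) / (n : ℝ) ^ (1 / 5 : ℝ)) := by
          have e2 : 250 * (Real.log (12 * n) / (n : ℝ) ^ (1 / 5 : ℝ)) *
              ((n : ℝ) ^ (4 / 5 : ℝ) * (n : ℝ) ^ (1 / 5 : ℝ))
              = 250 * (n : ℝ) ^ (4 / 5 : ℝ) * Real.log (12 * n) := by
            field_simp
          rw [div_eq_iff hn0.ne', ← e2, ← e1]
      _ = _ := by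
          rw [Real.log_mul (by norm_num) hn0.ne', add_div]

end Asymptotics

end DenseHamilton

open DenseHamilton in
theorem proposition1p4 :
    ∃ ε : ℕ → ℝ, Tendsto ε atTop (𝓝 0) ∧
      ∃ N : ℕ, ∀ n : ℕ, N ≤ n →
        ∀ (V : Type u) [Fintype V] [DecidableEq V] (G : SimpleGraph V) [DecidableRel G.Adj],
          Fintype.card V = n →
          (n : ℝ) / 2 ≤ (G.minDegree : ℝ) →
          ((DenseHamilton.reg G : ℝ) / Real.exp 1) ^ n * (1 - ε n) ^ n ≤
            (DenseHamilton.numHamiltonCycles G : ℝ) := by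
  -- With this choice (1 - ε)ⁿ is exactly the inverse of the polynomial loss (12n)^(5t + 5), where t
  -- is `defect n`.
  refine ⟨fun n => 1 - Real.exp (-logError n), ?_, ?_⟩
  · have h1 : Tendsto (fun n => Real.exp (-logError n)) atTop (𝓝 (Real.exp (-0))) :=
      (Real.continuous_exp.tendsto _).comp tendsto_logError.neg
    simpa using h1.const_sub 1
  · have h1 : ∀ᶠ n in atTop, logError n < 1 := tendsto_logError.eventually (gt_mem_nhds one_pos)
    obtain ⟨N, hN⟩ := eventually_atTop.1 (h1.and (eventually_ge_atTop 3))
    refine ⟨N, fun n hn V _ _ G _ hV hdeg => ?_⟩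
    obtain ⟨herr, hn3⟩ := hN n hn
    subst hV
    set n := Fintype.card V
    have hn3R : (3 : ℝ) ≤ n := by exact_mod_cast hn3
    have hn0 : (0 : ℝ) < n := by linarith
    have hlog : 1 ≤ Real.log (12 * n) := by
      rw [Real.le_log_iff_exp_le (by linarith)]
      have := Real.exp_one_lt_three
      linarith
    -- Since log(12n) ≥ 1, an error below 1 already forces 5t + 5 < n.
    have hdef : defect n ≤ n := by
      unfold logError at herr
      rw [div_lt_one hn0] at herr
      have h2 : ((5 * defect n + 5 : ℕ) : ℝ) ≤ (5 * defect n + 5 : ℕ) * Real.log (12 * n) :=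
        le_mul_of_one_le_right (by positivity) hlog
      have h3 : ((5 * defect n + 5 : ℕ) : ℝ) < n := lt_of_le_of_lt h2 herr
      have h4 : 5 * defect n + 5 < n := by exact_mod_cast h3
      omega
    have hs := one_le_layerRoot (show 1 ≤ n by omega)
    have hsR : (1 : ℝ) ≤ layerRoot n := by exact_mod_cast hs
    have hdef0 : 0 < defect n := Nat.ceil_pos.2 (by positivity)
    have hdegN : n ≤ 2 * G.minDegree := by
      have : (n : ℝ) ≤ 2 * G.minDegree := by linarith
      exact_mod_cast this
    have hmain := reg_div_exp_pow_le G hn3 hdegN (layerRoot n) (defect n) hs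
      (layerRoot_pow_le_self (by omega)) hdef0 hdef (Nat.le_ceil _)
    have hpow : (1 - (1 - Real.exp (-logError n))) ^ n
        = ((12 * n : ℝ) ^ (5 * defect n + 5))⁻¹ := by
      rw [sub_sub_cancel, ← Real.exp_nat_mul]
      have e1 : (n : ℝ) * -logError n = -((5 * defect n + 5 : ℕ) * Real.log (12 * n)) := by
        unfold logError; field_simp
      rw [e1, Real.exp_neg, Real.exp_nat_mul, Real.exp_log (by linarith)]
    have hD : 0 < (12 * n : ℝ) ^ (5 * defect n + 5) := by positivity
    simp only [hpow]
    rw [← div_eq_mul_inv, div_le_iff₀ hD, mul_comm (numHamiltonCycles G : ℝ)]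
    exact hmain
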